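/- Let $d,s\ge 1$ be natural numbers with $s>d/2$. A matrix $B\in\mathbb{R}^{d\times d}$ is called a Frolov matrix if (a) $B$ is invertible, (b) $\bigl|\prod_{j=1}^d (Bm)_j\bigr|\ge 1$ for every $m\in\mathbb{Z}^d\setminus\{0\}$, and (c) for all $x,y\in\mathbb{R}^d$ the box $\{z\in\mathbb{R}^d : z_j \text{ lies between } x_j \text{ and } y_j \text{ (inclusive) for all } j\}$ contains at most $\prod_{j=1}^d|x_j-y_j|+1$ points of the lattice $B\mathbb{Z}^d$. For an invertible matrix $S\in\mathbb{R}^{d\times d}$, a shift $v\in\mathbb{R}^d$ and a continuous function $f:\mathbb{R}^d\to\mathbb{R}$ with compact support let $$Q_S^v(f)=\frac{1}{|\det S|}\sum_{m\in\mathbb{Z}^d} f\bigl(S^{-\top}(m+v)\bigr),\qquad I_d(f)=\int_{\mathbb{R}^d} f(x)\,dx .$$ Let $\mathring H^s([0,1]^d)$ be the space of continuous functions $f:\mathbb{R}^d\to\mathbb{R}$ with support in $[0,1]^d$ such that the weak derivative $D^\alpha f$ exists and lies in $L^2(\mathbb{R}^d)$ for every $\alpha\in\mathbb{N}_0^d$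 with $|\alpha|=\alpha_1+\dots+\alpha_d\le s$, and let $$\|f\|_{H^s([0,1]^d)}=\Bigl(\sum_{|\alpha|\le s}\|D^\alpha f\|_{L^2([0,1]^d)}^2\Bigr)^{1/2}.$$ **Theorem.** Let $B\in\mathbb{R}^{d\times d}$ be a Frolov matrix. There is a constant $c>0$, depending only on $d$, $s$ and $B$, such that for every random vector $U$ that is uniformly distributed in the box $[1,2^{1/d}]^d$, with $\hat U=\operatorname{diag}(U_1,\dots,U_d)$, every natural number $n\ge 1$, every shift $v\in\mathbb{R}^d$ and every $f\in\mathring H^s([0,1]^d)$, the error $\bigl|Q^v_{n^{1/d}\hat U B}(f)-I_d(f)\bigr|$ is an integrable random variable and $$\mathbb{E}\,\bigl|Q^v_{n^{1/d}\hat U B}(f)-I_d(f)\bigr|\;\le\; c\,n^{-s/d-1/2}\,\|f\|_{H^s([0,1]^d)} .$$ -/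

import Mathlib

open MeasureTheory
open scoped Matrix

namespace FrolovQuadrature

noncomputable section

/-! ### The isotropic Sobolev spaces -/

/-- The classical partial derivative of `φ : ℝᵈ → ℝ` in the `j`-th coordinate direction. -/
def partialDeriv {d : ℕ} (j : Fin d) (φ : EuclideanSpace ℝ (Fin d) → ℝ) :
    EuclideanSpace ℝ (Fin d) → ℝ :=
  fun x => fderiv ℝ φ x (EuclideanSpace.single j 1)

/-- The classical derivative `∂₁^{α₁} ⋯ ∂_d^{α_d} φ` for a multi-index `α`
(used for smooth functions `φ` only, so that the order is irrelevant). -/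
def multiDeriv {d : ℕ} (α : Fin d → ℕ) (φ : EuclideanSpace ℝ (Fin d) → ℝ) :
    EuclideanSpace ℝ (Fin d) → ℝ :=
  (List.finRange d).foldr (fun j ψ => (partialDeriv j)^[α j] ψ) φ

/-- `g` is a weak derivative `D^α f` of `f` on the open set `G ⊆ ℝᵈ`. -/
structure IsWeakDeriv {d : ℕ} (G : Set (EuclideanSpace ℝ (Fin d))) (α : Fin d → ℕ)
    (f g : EuclideanSpace ℝ (Fin d) → ℝ) : Prop where
  locallyIntegrableOn_left : LocallyIntegrableOn f G
  locallyIntegrableOn_right : LocallyIntegrableOn g G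
  integral_eq : ∀ φ : EuclideanSpace ℝ (Fin d) → ℝ, ContDiff ℝ (⊤ : ℕ∞) φ →
    HasCompactSupport φ → tsupport φ ⊆ G →
      ∫ x in G, f x * multiDeriv α φ x = (-1) ^ (∑ j, α j) * ∫ x in G, g x * φ x

open Classical in
/-- The weak derivative `D^α f` on the open set `G`, which is unique up to null sets
(and `0` if there is none). -/
def weakDeriv {d : ℕ} (G : Set (EuclideanSpace ℝ (Fin d))) (α : Fin d → ℕ)
    (f : EuclideanSpace ℝ (Fin d) → ℝ) : EuclideanSpace ℝ (Fin d) → ℝ :=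
  if h : ∃ g, IsWeakDeriv G α f g then h.choose else 0

/-- The finite set of all multi-indices `α ∈ ℕ₀ᵈ` with `|α| = α₁ + ⋯ + α_d ≤ s`. -/
def multiIndices (d s : ℕ) : Finset (Fin d → ℕ) :=
  (Fintype.piFinset fun _ => Finset.range (s + 1)).filter fun α => ∑ j, α j ≤ s

theorem mem_multiIndices {d s : ℕ} (α : Fin d → ℕ) :
    α ∈ multiIndices d s ↔ ∑ j, α j ≤ s := by
  simp only [multiIndices, Finset.mem_filter, Fintype.mem_piFinset, Finset.mem_range,
    and_iff_right_iff_imp]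
  intro h j
  exact Nat.lt_succ_of_le
    ((Finset.single_le_sum (fun i _ => Nat.zero_le (α i)) (Finset.mem_univ j)).trans h)

/-- `f ∈ H^s(G)`: `f` and all its weak derivatives up to order `s` are in `L²(G)`. -/
def MemSobolev {d : ℕ} (G : Set (EuclideanSpace ℝ (Fin d))) (s : ℕ)
    (f : EuclideanSpace ℝ (Fin d) → ℝ) : Prop :=
  MemLp f 2 (volume.restrict G) ∧
    ∀ α : Fin d → ℕ, ∑ j, α j ≤ s →
      ∃ g, IsWeakDeriv G α f g ∧ MemLp g 2 (volume.restrict G)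

/-- The norm `(∑_{|α| ≤ s} ‖D^α f‖²_{L²(G)})^{1/2}` of `f ∈ H^s(G)`. -/
def sobolevNorm {d : ℕ} (G : Set (EuclideanSpace ℝ (Fin d))) (s : ℕ)
    (f : EuclideanSpace ℝ (Fin d) → ℝ) : ℝ :=
  Real.sqrt (∑ α ∈ multiIndices d s, ∫ x in G, (weakDeriv G α f x) ^ 2)

/-- The unit cube `[0,1]ᵈ`. -/
def unitCube (d : ℕ) : Set (EuclideanSpace ℝ (Fin d)) :=
  {x | ∀ j, x j ∈ Set.Icc (0 : ℝ) 1}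

/-- The open unit cube `(0,1)ᵈ`. -/
def openUnitCube (d : ℕ) : Set (EuclideanSpace ℝ (Fin d)) :=
  {x | ∀ j, x j ∈ Set.Ioo (0 : ℝ) 1}

/-- `f ∈ H̊^s([0,1]ᵈ)`: `f` is a function in `H^s(ℝᵈ)`, represented by a continuous function,
whose support is contained in the unit cube. -/
structure MemSobolevCube (d s : ℕ) (f : EuclideanSpace ℝ (Fin d) → ℝ) : Prop where
  continuous : Continuous f
  memSobolev : MemSobolev Set.univ s f
  tsupport_subset : tsupport f ⊆ unitCube d

/-- The norm of `H^s([0,1]ᵈ)`; the boundary of the cube is a null set and carries no test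
functions. -/
def sobolevNormCube (d s : ℕ) (f : EuclideanSpace ℝ (Fin d) → ℝ) : ℝ :=
  sobolevNorm (openUnitCube d) s f

/-! ### The quadrature rule -/

/-- The quadrature rule `Q_S^v(f) = |det S|⁻¹ ∑_{m ∈ ℤᵈ} f(S^{-⊤}(m + v))`. -/
def quadrature {d : ℕ} (S : Matrix (Fin d) (Fin d) ℝ) (v : Fin d → ℝ)
    (f : EuclideanSpace ℝ (Fin d) → ℝ) : ℝ :=
  |S.det|⁻¹ * ∑' m : Fin d → ℤ, f (WithLp.toLp 2 ((S⁻¹)ᵀ *ᵥ fun j => (m j : ℝ) + v j))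

/-- Frolov matrices. -/
structure IsFrolovMatrix {d : ℕ} (B : Matrix (Fin d) (Fin d) ℝ) : Prop where
  isUnit : IsUnit B
  one_le_abs_prod : ∀ m : Fin d → ℤ, m ≠ 0 →
    1 ≤ |∏ j, (B *ᵥ fun i => (m i : ℝ)) j|
  /-- The closed box spanned by `x` and `y` contains at most `∏ⱼ |xⱼ - yⱼ| + 1` points of the
  lattice `B ℤᵈ`. -/
  card_le : ∀ x y : Fin d → ℝ,
    (Set.range (fun m : Fin d → ℤ => B *ᵥ fun i => (m i : ℝ)) ∩
      {z | ∀ j, z j ∈ Set.uIcc (x j) (y j)}).Finite ∧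
    ((Set.range (fun m : Fin d → ℤ => B *ᵥ fun i => (m i : ℝ)) ∩
      {z | ∀ j, z j ∈ Set.uIcc (x j) (y j)}).ncard : ℝ) ≤ ∏ j, |x j - y j| + 1

/-- The matrix `n^{1/d} diag(u) B`. -/
def dilatedMatrix {d : ℕ} (n : ℕ) (u : Fin d → ℝ) (B : Matrix (Fin d) (Fin d) ℝ) :
    Matrix (Fin d) (Fin d) ℝ :=
  ((n : ℝ) ^ (1 / (d : ℝ))) • (Matrix.diagonal u * B)

/-- The box `[1, 2^{1/d}]ᵈ` of dilation parameters. -/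
def dilationBox (d : ℕ) : Set (Fin d → ℝ) :=
  Set.Icc (fun _ => 1) (fun _ => (2 : ℝ) ^ (1 / (d : ℝ)))

end

end FrolovQuadrature

open FrolovQuadrature

/-! Poisson summation turns the quadrature error for `S` into the sum of the Fourier transform of
`f` over the nonzero points of the lattice `S ℤᵈ`, weighted by characters in `v`. Taking absolute
values removes the shift, so the bound is uniform in `v` (`enorm_quadrature_sub_integral_le`).

For `S = n^{1/d} Û B` and fixed `m ≠ 0`, the random point `S m` is uniformly distributed in a box
whose volume is proportional to the product of the coordinates of `n^{1/d} B m`. The mean of the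
dual sum is therefore an integral of `|f̂|` against a density that counts these boxes with weights.
Frolov property (b) keeps every box outside the hyperbolic cross `∏ |xⱼ| < n`. Property (c) bounds
the density at `x` by a multiple of `1/n`: about `∏ |xⱼ| / n` boxes contain `x`, each with weight of
order `1 / ∏ |xⱼ|` (`frolov_prod_bounds`, `tsum_overlap_le`).

It remains to bound `∫ |f̂|` over `∏ |ξⱼ| ≥ n`. This region lies in `‖ξ‖ ≥ n^{1/d}` for the sup
norm, so Cauchy–Schwarz with the weight `‖ξ‖^s` gives the square root of `∫_{‖ξ‖ ≥ n^{1/d}}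
‖ξ‖^{-2s}`, of order `n^{1/2 - s/d}` and finite because `2s > d`, times a weighted `L²` norm of
`f̂`. Plancherel bounds the latter by the pure derivatives of order `s`
(`lintegral_coordFourier_outside_le`). Multiplication by `1/n` yields the rate. -/

open scoped ENNReal

/-! ### Periodization and Poisson summation. -/

section Poisson

variable {ι : Type*}

/-- The half-open unit cell `(0,1]^ι`. -/
def unitCell (ι : Type*) : Set (ι → ℝ) := {x | ∀ i, x i ∈ Set.Ioc (0 : ℝ) (0 + 1)}

/-- The inclusion of the integer lattice. -/
def intVec (m : ι → ℤ) : ι → ℝ := fun i => (m i : ℝ)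

theorem intVec_injective : Function.Injective (intVec : (ι → ℤ) → ι → ℝ) := fun a b h => by
  funext i
  exact Int.cast_injective (α := ℝ) (congrFun h i)

theorem intVec_zero : intVec (0 : ι → ℤ) = 0 := by
  funext i; simp [intVec]

/-- Ceilings index the translates of a cell that is open on the left, so covering and disjointness
can be read off from `⌈x i⌉ - 1`. -/
theorem mem_unitCell_iff (x : ι → ℝ) : x ∈ unitCell ι ↔ ∀ i, ⌈x i⌉ = 1 := by
  refine forall_congr' fun i => ?_
  rw [Int.ceil_eq_iff]
  simp

variable [Fintype ι]

theorem measurableSet_unitCell : MeasurableSet (unitCell ι) := by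
  have : unitCell ι = Set.univ.pi fun _ => Set.Ioc (0 : ℝ) (0 + 1) := by
    ext x; simp [unitCell]
  rw [this]
  exact MeasurableSet.univ_pi fun _ => measurableSet_Ioc

/-- Lebesgue measure is the sum of the translates of its restriction to the unit cell. -/
theorem sum_map_restrict_unitCell :
    Measure.sum (fun m : ι → ℤ => ((volume : Measure (ι → ℝ)).restrict (unitCell ι)).map
      (· + intVec m)) = volume := by
  have key : ∀ m : ι → ℤ, ((volume : Measure (ι → ℝ)).restrict (unitCell ι)).map
      (· + intVec m) = volume.restrict ((· + intVec m) '' unitCell ι) := fun m => by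
    have h := (measurePreserving_add_right (volume : Measure (ι → ℝ)) (intVec m)).restrict_image_emb
      (MeasurableEquiv.addRight (intVec m)).measurableEmbedding (unitCell ι)
    exact h.map_eq
  have mem : ∀ (m : ι → ℤ) (x : ι → ℝ),
      x ∈ (· + intVec m) '' unitCell ι ↔ ∀ i, ⌈x i⌉ = m i + 1 := fun m x => by
    have : x ∈ (· + intVec m) '' unitCell ι ↔ x - intVec m ∈ unitCell ι := by
      constructor
      · rintro ⟨y, hy, rfl⟩; simpa using hy
      · intro h; exact ⟨_, h, by simp⟩
    rw [this, mem_unitCell_iff]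
    refine forall_congr' fun i => ?_
    simp [intVec, sub_eq_iff_eq_add']
  simp_rw [key]
  rw [← Measure.restrict_iUnion]
  · rw [Set.iUnion_eq_univ_iff.2, Measure.restrict_univ]
    exact fun x => ⟨fun i => ⌈x i⌉ - 1, (mem _ _).2 fun i => (sub_add_cancel _ _).symm⟩
  · intro a b hab
    refine Set.disjoint_left.2 fun x hx hx' => hab ?_
    funext i
    exact add_right_cancel (((mem a x).1 hx i).symm.trans ((mem b x).1 hx' i))
  · intro m
    exact (MeasurableEquiv.addRight (intVec m)).measurableEmbedding.measurableSet_image.2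
      measurableSet_unitCell

theorem lintegral_eq_tsum_unitCell (h : (ι → ℝ) → ℝ≥0∞) (hh : Measurable h) :
    ∫⁻ x, h x = ∑' m : ι → ℤ, ∫⁻ x in unitCell ι, h (x + intVec m) := by
  conv_lhs => rw [← sum_map_restrict_unitCell, lintegral_sum_measure]
  refine tsum_congr fun m => ?_
  rw [lintegral_map hh (by fun_prop)]

theorem integral_eq_tsum_unitCell (h : (ι → ℝ) → ℂ) (hh : Integrable h) :
    ∫ x, h x = ∑' m : ι → ℤ, ∫ x in unitCell ι, h (x + intVec m) := by
  have hh' := hh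
  rw [← sum_map_restrict_unitCell] at hh'
  conv_lhs => rw [← sum_map_restrict_unitCell, integral_sum_measure hh']
  refine tsum_congr fun m => ?_
  exact (MeasurableEquiv.addRight (intVec m)).measurableEmbedding.integral_map h

/-- The unfolding step of Poisson summation; integrability of `h` justifies the exchange of sum and
integral. -/
theorem integral_unitCell_tsum (h : (ι → ℝ) → ℂ) (hh : Integrable h) (hm : Measurable h) :
    ∫ x in unitCell ι, ∑' m : ι → ℤ, h (x + intVec m) = ∫ x, h x := by
  rw [integral_eq_tsum_unitCell h hh, integral_tsum]
  · intro m
    exact (hm.comp (measurable_id.add_const _)).aestronglyMeasurable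
  · rw [← lintegral_eq_tsum_unitCell (fun x => ‖h x‖ₑ) hm.enorm]
    exact hh.2.ne

/-- The character `x ↦ exp (-2πi ξ·x)`. -/
noncomputable def expChar (ξ x : ι → ℝ) : ℂ :=
  Complex.exp (-(2 * Real.pi * (ξ ⬝ᵥ x) : ℝ) * Complex.I)

/-- The Fourier transform on `ℝ^ι`. -/
noncomputable def coordFourier (F : (ι → ℝ) → ℂ) (ξ : ι → ℝ) : ℂ := ∫ x, expChar ξ x * F x

theorem norm_expChar (ξ x : ι → ℝ) : ‖expChar ξ x‖ = 1 := by
  rw [expChar, ← Complex.ofReal_neg, Complex.norm_exp_ofReal_mul_I]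

theorem expChar_add_left (ξ η x : ι → ℝ) : expChar (ξ + η) x = expChar ξ x * expChar η x := by
  rw [expChar, expChar, expChar, ← Complex.exp_add, add_dotProduct]
  congr 1
  push_cast
  ring

theorem expChar_add_right (ξ x y : ι → ℝ) : expChar ξ (x + y) = expChar ξ x * expChar ξ y := by
  rw [expChar, expChar, expChar, ← Complex.exp_add, dotProduct_add]
  congr 1
  push_cast
  ring

theorem continuous_expChar_right (ξ : ι → ℝ) : Continuous (expChar ξ) := by
  unfold expChar dotProduct; fun_prop

theorem continuous_expChar_left (x : ι → ℝ) : Continuous fun ξ => expChar ξ x := by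
  unfold expChar dotProduct; fun_prop

theorem mFourier_neg_coe (k : ι → ℤ) (x : ι → ℝ) :
    UnitAddTorus.mFourier (-k) (fun i => (x i : UnitAddCircle)) = expChar (intVec k) x := by
  simp only [UnitAddTorus.mFourier, ContinuousMap.coe_mk, expChar, dotProduct]
  rw [show (-(2 * Real.pi * ∑ i, intVec k i * x i : ℝ) * Complex.I : ℂ) =
    ∑ i, (2 * Real.pi * Complex.I * (-k i) * x i / 1) by
      push_cast
      rw [Finset.mul_sum, ← Finset.sum_neg_distrib, Finset.sum_mul]
      exact Finset.sum_congr rfl fun i _ => by simp [intVec]; ring, Complex.exp_sum]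
  refine Finset.prod_congr rfl fun i _ => ?_
  rw [fourier_coe_apply]
  simp

theorem expChar_intVec (k m : ι → ℤ) : expChar (intVec k) (intVec m) = 1 := by
  rw [expChar, Complex.exp_eq_one_iff]
  refine ⟨-∑ i, k i * m i, ?_⟩
  simp only [dotProduct, intVec]
  push_cast
  ring

theorem mFourierCoeff_eq_unitCell (G : UnitAddTorus ι → ℂ) (k : ι → ℤ) :
    UnitAddTorus.mFourierCoeff G k =
      ∫ x in unitCell ι, expChar (intVec k) x * G (fun i => x i) := by
  -- With base point `0` the domain of integration is `unitCell` by definition, with the endpoint in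
  -- the form `0 + 1`.
  rw [UnitAddTorus.mFourierCoeff_eq_integral G k (fun _ => 0)]
  simp_rw [mFourier_neg_coe, smul_eq_mul]
  rfl

theorem finite_intVec_norm_le (R : ℝ) : {m : ι → ℤ | ‖intVec m‖ ≤ R}.Finite := by
  have : {m : ι → ℤ | ‖intVec m‖ ≤ R} ⊆ Metric.closedBall 0 R := by
    intro m hm
    rw [mem_closedBall_zero_iff]
    have hR := (norm_nonneg _).trans hm
    rw [pi_norm_le_iff_of_nonneg hR]
    intro i
    rw [Int.norm_eq_abs]
    exact (norm_le_pi_norm (intVec m) i).trans hm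
  exact ((isCompact_closedBall _ _).finite_of_discrete).subset this

theorem locallyFinite_support_translates {F : (ι → ℝ) → ℂ} (hc : HasCompactSupport F) :
    LocallyFinite fun m : ι → ℤ => Function.support fun x => F (x + intVec m) := by
  intro x
  obtain ⟨R, hR⟩ := hc.isBounded.subset_closedBall 0
  refine ⟨Metric.ball x 1, Metric.ball_mem_nhds _ one_pos,
    (finite_intVec_norm_le (R + (‖x‖ + 1))).subset ?_⟩
  rintro m ⟨y, hy, hyx⟩
  have h1 := hR (subset_tsupport _ hy)
  rw [mem_closedBall_zero_iff] at h1
  have h2 : ‖y‖ < ‖x‖ + 1 := by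
    rw [Metric.mem_ball, dist_eq_norm] at hyx
    linarith [norm_le_norm_add_norm_sub' y x]
  have h3 : ‖intVec m‖ ≤ ‖y + intVec m‖ + ‖y‖ := by
    simpa using norm_sub_le (y + intVec m) y
  simp only [Set.mem_ofPred_eq]
  linarith

/-- Compact support makes the sum locally finite, hence continuous. It is invariant under integer
shifts, so it descends along the quotient map onto the torus. -/
theorem exists_periodization {F : (ι → ℝ) → ℂ} (hF : Continuous F) (hc : HasCompactSupport F) :
    ∃ G : C(UnitAddTorus ι, ℂ), ∀ x : ι → ℝ,
      G (fun i => (x i : UnitAddCircle)) = ∑' m : ι → ℤ, F (x + intVec m) := by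
  have hcont : Continuous fun x => ∑' m : ι → ℤ, F (x + intVec m) := by
    have h := continuous_finsum (f := fun (m : ι → ℤ) x => F (x + intVec m))
      (fun m => by fun_prop) (locallyFinite_support_translates hc)
    refine h.congr fun x => (tsum_eq_finsum ?_).symm
    exact (locallyFinite_support_translates hc).point_finite x
  let p : C(ι → ℝ, UnitAddTorus ι) :=
    ⟨fun x i => (x i : UnitAddCircle), continuous_pi fun i =>
      (AddCircle.continuous_mk' 1).comp (continuous_apply i)⟩
  have hq : Topology.IsQuotientMap p :=
    (IsOpenQuotientMap.piMap (f := fun _ : ι => ((↑) : ℝ → UnitAddCircle))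
      fun _ => QuotientAddGroup.isOpenQuotientMap_mk).isQuotientMap
  let per : C(ι → ℝ, ℂ) := ⟨_, hcont⟩
  have hfac : Function.FactorsThrough per p := by
    intro x y hxy
    have : ∀ i, ∃ n : ℤ, n = x i - y i := fun i => by
      have h := congrFun hxy i
      obtain ⟨n, hn⟩ := (QuotientAddGroup.eq_iff_sub_mem (N := AddSubgroup.zmultiples (1 : ℝ))).1 h
      exact ⟨n, by simpa using hn⟩
    choose n hn using this
    have hx : x = y + intVec n := by
      funext i; simp [intVec, hn]
    change ∑' m : ι → ℤ, F (x + intVec m) = ∑' m : ι → ℤ, F (y + intVec m)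
    rw [← (Equiv.addLeft n).tsum_eq fun m => F (y + intVec m)]
    refine tsum_congr fun m => ?_
    rw [hx]
    congr 1
    funext i
    simp [intVec, add_assoc]
  exact ⟨hq.lift per hfac, fun x => DFunLike.congr_fun (hq.lift_comp per hfac) x⟩

/-- Poisson summation for a continuous compactly supported function with summable
Fourier coefficients. -/
theorem hasSum_poisson {F : (ι → ℝ) → ℂ} (hF : Continuous F) (hc : HasCompactSupport F)
    (hs : Summable fun k : ι → ℤ => coordFourier F (intVec k)) (v : ι → ℝ) :
    HasSum (fun k : ι → ℤ => coordFourier F (intVec k) * expChar (intVec (-k)) v)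
      (∑' m : ι → ℤ, F (v + intVec m)) := by
  obtain ⟨G, hG⟩ := exists_periodization hF hc
  -- An integer character equals `1` on the integer lattice, so it can be moved inside the
  -- periodization before unfolding.
  have hcoeff : UnitAddTorus.mFourierCoeff G = fun k : ι → ℤ => coordFourier F (intVec k) := by
    funext k
    have hcont : Continuous fun x => expChar (intVec k) x * F x :=
      (continuous_expChar_right _).mul hF
    rw [mFourierCoeff_eq_unitCell, coordFourier, ← integral_unitCell_tsum
      (fun x => expChar (intVec k) x * F x) (hcont.integrable_of_hasCompactSupport hc.mul_left)
      hcont.measurable]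
    refine integral_congr_ae (Filter.Eventually.of_forall fun x => ?_)
    simp only [hG, ← tsum_mul_left, expChar_add_right, expChar_intVec, mul_one]
  have h := UnitAddTorus.hasSum_mFourier_series_apply_of_summable (f := G)
    (by rw [hcoeff]; exact hs) (fun i => v i)
  rw [hG, hcoeff] at h
  convert h using 2 with k
  rw [smul_eq_mul, ← mFourier_neg_coe, neg_neg]

end Poisson

/-! ### The quadrature error as a sum over the dual lattice. -/

section Quadrature

variable {d : ℕ}

/-- A real function on Euclidean space, viewed as a complex function of the coordinates. -/
def coordFun (f : EuclideanSpace ℝ (Fin d) → ℝ) : (Fin d → ℝ) → ℂ :=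
  fun x => (f (WithLp.toLp 2 x) : ℂ)

theorem continuous_coordFun {f : EuclideanSpace ℝ (Fin d) → ℝ} (hf : Continuous f) :
    Continuous (coordFun f) :=
  Complex.continuous_ofReal.comp (hf.comp (PiLp.continuous_toLp 2 _))

theorem hasCompactSupport_coordFun {f : EuclideanSpace ℝ (Fin d) → ℝ} (hf : HasCompactSupport f) :
    HasCompactSupport (coordFun f) := by
  have h := hf.comp_homeomorph (PiLp.homeomorph 2 (fun _ : Fin d => ℝ)).symm
  exact h.comp_left (g := ((↑) : ℝ → ℂ)) Complex.ofReal_zero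

theorem integral_toLp {E : Type*} [NormedAddCommGroup E] [NormedSpace ℝ E]
    (g : EuclideanSpace ℝ (Fin d) → E) :
    ∫ x : Fin d → ℝ, g (WithLp.toLp 2 x) = ∫ x, g x :=
  (PiLp.volume_preserving_toLp (Fin d)).integral_comp
    (MeasurableEquiv.toLp 2 (Fin d → ℝ)).measurableEmbedding g

theorem integral_coordFun (f : EuclideanSpace ℝ (Fin d) → ℝ) :
    ((∫ x, f x : ℝ) : ℂ) = ∫ x, coordFun f x := by
  rw [← integral_complex_ofReal, ← integral_toLp]
  rfl

theorem coordFourier_zero (F : (Fin d → ℝ) → ℂ) : coordFourier F 0 = ∫ x, F x := by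
  simp [coordFourier, expChar]

/-- Substitute `y = S^{-⊤} x`; then `ξ·x = (S ξ)·y`. This is what places the frequencies on `S ℤᵈ`.
-/
theorem coordFourier_comp_matrix {F : (Fin d → ℝ) → ℂ} (hF : Continuous F)
    {S : Matrix (Fin d) (Fin d) ℝ} (hS : S.det ≠ 0) (ξ : Fin d → ℝ) :
    coordFourier (fun x => F ((S⁻¹)ᵀ *ᵥ x)) ξ = |S.det| * coordFourier F (S *ᵥ ξ) := by
  have hdet : (S⁻¹)ᵀ.det = S.det⁻¹ := by
    rw [Matrix.det_transpose, Matrix.det_nonsing_inv, Ring.inverse_eq_inv']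
  have hdet0 : (S⁻¹)ᵀ.det ≠ 0 := by rw [hdet]; exact inv_ne_zero hS
  have hmap := Real.map_matrix_volume_pi_eq_smul_volume_pi hdet0
  have hcont : Continuous fun y => expChar (S *ᵥ ξ) y * F y :=
    (continuous_expChar_right _).mul hF
  have h := integral_map (μ := (volume : Measure (Fin d → ℝ)))
    (φ := Matrix.toLin' (S⁻¹)ᵀ) (f := fun y => expChar (S *ᵥ ξ) y * F y)
    (LinearMap.continuous_of_finiteDimensional _).aemeasurable hcont.aestronglyMeasurable
  rw [hmap, integral_smul_measure, hdet, inv_inv, ENNReal.toReal_ofReal (abs_nonneg _)] at h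
  rw [coordFourier, coordFourier, ← Complex.real_smul, h]
  refine integral_congr_ae (Filter.Eventually.of_forall fun x => ?_)
  simp only [Matrix.toLin'_apply, expChar]
  congr 5
  rw [Matrix.mulVec_transpose, dotProduct_comm (S *ᵥ ξ), ← Matrix.dotProduct_mulVec,
    Matrix.mulVec_mulVec, Matrix.nonsing_inv_mul _ (isUnit_iff_ne_zero.2 hS), Matrix.one_mulVec,
    dotProduct_comm]

theorem isUnit_det_inv_transpose {S : Matrix (Fin d) (Fin d) ℝ} (hS : S.det ≠ 0) :
    IsUnit ((S⁻¹)ᵀ).det := by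
  rw [Matrix.det_transpose]
  exact Matrix.isUnit_nonsing_inv_det _ (isUnit_iff_ne_zero.2 hS)

theorem hasCompactSupport_comp_mulVec {F : (Fin d → ℝ) → ℂ} (hF : HasCompactSupport F)
    {A : Matrix (Fin d) (Fin d) ℝ} (hA : IsUnit A.det) :
    HasCompactSupport fun x => F (A *ᵥ x) := by
  let e : (Fin d → ℝ) ≃L[ℝ] (Fin d → ℝ) :=
    (Matrix.toLinearEquiv' A ((Matrix.isUnit_iff_isUnit_det _).2 hA).invertible
      ).toContinuousLinearEquiv
  exact hF.comp_homeomorph e.toHomeomorph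

theorem summable_quadrature {f : EuclideanSpace ℝ (Fin d) → ℝ} (hc : HasCompactSupport f)
    {S : Matrix (Fin d) (Fin d) ℝ} (hS : S.det ≠ 0) (v : Fin d → ℝ) :
    Summable fun m : Fin d → ℤ =>
      f (WithLp.toLp 2 ((S⁻¹)ᵀ *ᵥ fun j => (m j : ℝ) + v j)) := by
  have h1 := (locallyFinite_support_translates (hasCompactSupport_comp_mulVec
    (hasCompactSupport_coordFun hc) (isUnit_det_inv_transpose hS))).point_finite v
  refine summable_of_hasFiniteSupport (h1.subset fun m hm => ?_)
  have h2 : v + intVec m = fun j => (m j : ℝ) + v j := by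
    funext j; exact add_comm _ _
  rw [Set.mem_ofPred_eq, Function.mem_support, h2]
  exact Complex.ofReal_ne_zero.2 hm

/-- The quadrature error is bounded by the sum of the Fourier transform over the dual lattice
without the origin. -/
theorem enorm_quadrature_sub_integral_le {f : EuclideanSpace ℝ (Fin d) → ℝ} (hf : Continuous f)
    (hc : HasCompactSupport f) {S : Matrix (Fin d) (Fin d) ℝ} (hS : S.det ≠ 0) (v : Fin d → ℝ) :
    ‖quadrature S v f - ∫ x, f x‖ₑ ≤
      ∑' k : Fin d → ℤ, if k = 0 then 0 else ‖coordFourier (coordFun f) (S *ᵥ intVec k)‖ₑ := by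
  -- If the bound is infinite there is nothing to prove; otherwise its finiteness is exactly the
  -- summability that Poisson summation needs, up to the single term `k = 0`.
  by_cases htop : (∑' k : Fin d → ℤ,
      if k = 0 then 0 else ‖coordFourier (coordFun f) (S *ᵥ intVec k)‖ₑ) = ∞
  · rw [htop]; exact le_top
  set F := coordFun f
  set A := (S⁻¹)ᵀ
  have hFc : Continuous fun x => F (A *ᵥ x) :=
    (continuous_coordFun hf).comp (Continuous.matrix_mulVec continuous_const continuous_id)
  have hFs : HasCompactSupport fun x => F (A *ᵥ x) :=
    hasCompactSupport_comp_mulVec (hasCompactSupport_coordFun hc) (isUnit_det_inv_transpose hS)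
  have hsum : Summable fun k : Fin d → ℤ => coordFourier F (S *ᵥ intVec k) := by
    have h1 : Summable fun k : Fin d → ℤ =>
        if k = 0 then 0 else coordFourier F (S *ᵥ intVec k) := by
      refine Summable.of_norm (tsum_enorm_ne_top_iff_summable_norm.1 ?_)
      convert htop using 4 with k
      split_ifs <;> simp
    have h2 := h1.add (summable_of_ne_finset_zero (s := {(0 : Fin d → ℤ)})
      (f := fun k => if k = 0 then coordFourier F (S *ᵥ intVec k) else 0)
      fun k hk => by simp at hk; simp [hk])
    refine h2.congr fun k => ?_
    split_ifs <;> simp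
  have hsum' : Summable fun k : Fin d → ℤ =>
      coordFourier (fun x => F (A *ᵥ x)) (intVec k) := by
    refine (hsum.mul_left ((|S.det| : ℝ) : ℂ)).congr fun k => ?_
    exact (coordFourier_comp_matrix (continuous_coordFun hf) hS _).symm
  have hP := (hasSum_poisson hFc hFs hsum' v).mul_left ((|S.det|⁻¹ : ℝ) : ℂ)
  have hterm : ∀ k : Fin d → ℤ, ((|S.det|⁻¹ : ℝ) : ℂ) *
      (coordFourier (fun x => F (A *ᵥ x)) (intVec k) * expChar (intVec (-k)) v) =
      coordFourier F (S *ᵥ intVec k) * expChar (intVec (-k)) v := fun k => by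
    rw [coordFourier_comp_matrix (continuous_coordFun hf) hS, ← mul_assoc, ← mul_assoc,
      ← Complex.ofReal_mul, inv_mul_cancel₀ (abs_ne_zero.2 hS), Complex.ofReal_one, one_mul]
  simp_rw [hterm] at hP
  have hQ : ((quadrature S v f : ℝ) : ℂ) =
      ((|S.det|⁻¹ : ℝ) : ℂ) * ∑' m : Fin d → ℤ, F (A *ᵥ (v + intVec m)) := by
    rw [quadrature, Complex.ofReal_mul, Complex.ofReal_tsum]
    congr 1
    refine tsum_congr fun m => ?_
    rw [add_comm v]
    rfl
  rw [← hQ] at hP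
  -- The zero frequency contributes the integral of `f`, so the remaining terms are the error.
  have hsplit := hP.summable.tsum_eq_add_tsum_ite 0
  rw [hP.tsum_eq, intVec_zero, Matrix.mulVec_zero, coordFourier_zero, ← integral_coordFun,
    neg_zero, intVec_zero] at hsplit
  have h0 : expChar (0 : Fin d → ℝ) v = 1 := by simp [expChar]
  rw [h0, mul_one, ← sub_eq_iff_eq_add', ← Complex.ofReal_sub] at hsplit
  have hnorm : ‖quadrature S v f - ∫ x, f x‖ₑ =
      ‖((quadrature S v f - ∫ x, f x : ℝ) : ℂ)‖ₑ := by
    rw [← ofReal_norm, ← ofReal_norm, Complex.norm_real]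
  rw [hnorm, hsplit]
  refine (enorm_tsum_le_tsum_enorm ).trans (ENNReal.tsum_le_tsum fun k => ?_)
  split_ifs
  · simp
  · rw [enorm_mul, ← ofReal_norm (expChar _ _), norm_expChar]
    simp

end Quadrature

/-! ### Averaging the dual lattice sum over random dilations. -/

section Averaging

variable {d : ℕ}

theorem measurableSet_dilationBox : MeasurableSet (dilationBox d) := measurableSet_Icc

theorem dilationFactor_pow (hd : 1 ≤ d) {x : ℝ} (hx : 0 ≤ x) : (x ^ (1 / (d : ℝ))) ^ d = x := by
  rw [one_div, Real.rpow_inv_natCast_pow hx (by omega)]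

theorem dilatedMatrix_mulVec (n : ℕ) (u : Fin d → ℝ) (B : Matrix (Fin d) (Fin d) ℝ)
    (w : Fin d → ℝ) :
    dilatedMatrix n u B *ᵥ w =
      fun j => ((n : ℝ) ^ (1 / (d : ℝ)) * (B *ᵥ w) j) * u j := by
  funext j
  rw [dilatedMatrix, Matrix.smul_mulVec, ← Matrix.mulVec_mulVec, Pi.smul_apply,
    Matrix.mulVec_diagonal, smul_eq_mul]
  ring

/-- The change of variables `x = b u`, written over the whole space with an indicator so that the
integrals for different lattice points can be summed under one integral sign. -/
theorem lintegral_dilationBox_comp_mul {h : (Fin d → ℝ) → ℝ≥0∞} (hh : Measurable h)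
    {b : Fin d → ℝ} (hb : ∏ j, b j ≠ 0) :
    ∫⁻ u in dilationBox d, h (fun j => b j * u j) =
      ∫⁻ x, ENNReal.ofReal |∏ j, b j|⁻¹ *
        {x | (fun j => x j / b j) ∈ dilationBox d}.indicator h x := by
  have hbj : ∀ j, b j ≠ 0 := fun j => Finset.prod_ne_zero_iff.1 hb j (Finset.mem_univ j)
  have hdet : (Matrix.diagonal b).det ≠ 0 := by rwa [Matrix.det_diagonal]
  have hmap := Real.map_matrix_volume_pi_eq_smul_volume_pi hdet
  have hms : MeasurableSet {x : Fin d → ℝ | (fun j => x j / b j) ∈ dilationBox d} := by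
    have : Measurable fun (x : Fin d → ℝ) j => x j / b j := by fun_prop
    exact this measurableSet_dilationBox
  have hk : Measurable ({x | (fun j => x j / b j) ∈ dilationBox d}.indicator h) :=
    hh.indicator hms
  have h1 := lintegral_map (μ := volume) hk
    (LinearMap.continuous_of_finiteDimensional (Matrix.toLin' (Matrix.diagonal b))).measurable
  rw [hmap, lintegral_smul_measure, Matrix.det_diagonal, abs_inv, smul_eq_mul] at h1
  rw [lintegral_const_mul _ hk, h1, ← lintegral_indicator measurableSet_dilationBox]
  refine lintegral_congr fun u => ?_
  have hu : Matrix.toLin' (Matrix.diagonal b) u = fun j => b j * u j := by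
    funext j
    rw [Matrix.toLin'_apply, Matrix.mulVec_diagonal]
  rw [hu]
  have hiff : u ∈ dilationBox d ↔
      (fun j => b j * u j) ∈ {x : Fin d → ℝ | (fun j => x j / b j) ∈ dilationBox d} := by
    have : (fun j => b j * u j / b j) = u := by
      funext j
      rw [mul_div_cancel_left₀ _ (hbj j)]
    rw [Set.mem_ofPred_eq, this]
  by_cases hu' : u ∈ dilationBox d
  · rw [Set.indicator_of_mem hu', Set.indicator_of_mem (hiff.1 hu')]
  · rw [Set.indicator_of_notMem hu', Set.indicator_of_notMem fun h => hu' (hiff.2 h)]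

/-- Write `xⱼ = uⱼ a wⱼ` with `1 ≤ uⱼ ≤ 2^{1/d}`, so that `1 ≤ ∏ uⱼ ≤ 2`. The three conclusions
place `x` outside the hyperbolic cross, bound the weight of the box of `w`, and confine `w` to a box
depending only on `x`, in which lattice points can be counted. -/
theorem frolov_prod_bounds (hd : 1 ≤ d) {w x : Fin d → ℝ} (hw : 1 ≤ |∏ j, w j|) {a : ℝ}
    (ha : 0 < a) (hx : (fun j => x j / (a * w j)) ∈ dilationBox d) :
    a ^ d ≤ ∏ j, |x j| ∧ ∏ j, |x j| ≤ 2 * |∏ j, a * w j| ∧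
      ∀ j, w j ∈ Set.uIcc 0 (x j / a) := by
  have hwj : ∀ j, w j ≠ 0 := fun j => by
    have : ∏ j, w j ≠ 0 := fun h => by rw [h, abs_zero] at hw; linarith
    exact Finset.prod_ne_zero_iff.1 this j (Finset.mem_univ j)
  obtain ⟨u, hu⟩ : ∃ u : Fin d → ℝ, u = fun j => x j / (a * w j) := ⟨_, rfl⟩
  rw [← hu] at hx
  have hu1 : ∀ j, 1 ≤ u j := fun j => hx.1 j
  have hu2 : ∀ j, u j ≤ (2 : ℝ) ^ (1 / (d : ℝ)) := fun j => hx.2 j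
  have hxu : ∀ j, x j = u j * (a * w j) := fun j => by
    rw [hu]; field_simp [hwj j]
  have hprod : ∏ j, |x j| = (∏ j, u j) * |∏ j, a * w j| := by
    rw [Finset.abs_prod, ← Finset.prod_mul_distrib]
    refine Finset.prod_congr rfl fun j _ => ?_
    rw [hxu j, abs_mul (u j), abs_of_nonneg (zero_le_one.trans (hu1 j))]
  have haw : |∏ j, a * w j| = a ^ d * |∏ j, w j| := by
    rw [Finset.prod_mul_distrib, abs_mul, Finset.prod_const, Finset.card_univ, Fintype.card_fin,
      abs_of_pos (pow_pos ha d)]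
  have hP1 : 1 ≤ ∏ j, u j := by
    simpa using Finset.prod_le_prod (s := Finset.univ) (f := fun _ : Fin d => (1 : ℝ)) (g := u)
      (fun _ _ => zero_le_one) fun j _ => hu1 j
  have hP2 : ∏ j, u j ≤ 2 := by
    calc ∏ j, u j ≤ ∏ _j : Fin d, (2 : ℝ) ^ (1 / (d : ℝ)) :=
          Finset.prod_le_prod (fun j _ => zero_le_one.trans (hu1 j)) fun j _ => hu2 j
      _ = 2 := by
          rw [Finset.prod_const, Finset.card_univ, Fintype.card_fin,
            dilationFactor_pow hd zero_le_two]
  refine ⟨?_, ?_, fun j => ?_⟩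
  · rw [hprod, haw]
    have := pow_pos ha d
    nlinarith [mul_le_mul hP1 hw zero_le_one (zero_le_one.trans hP1)]
  · rw [hprod]
    exact mul_le_mul_of_nonneg_right hP2 (abs_nonneg _)
  · have h1 : x j / a = u j * w j := by rw [hxu j]; field_simp
    rw [h1, Set.mem_uIcc]
    rcases le_total 0 (w j) with h | h
    · left; exact ⟨h, by nlinarith [hu1 j]⟩
    · right; exact ⟨by nlinarith [hu1 j], h⟩

/-- The overlap bound: the weighted number of dilated lattice points for which `x` lies in the
corresponding box is at most `4 / n`. -/
theorem tsum_overlap_le (hd : 1 ≤ d) {B : Matrix (Fin d) (Fin d) ℝ} (hB : IsFrolovMatrix B)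
    {n : ℕ} (hn : 1 ≤ n) {a : ℝ} (ha : 0 < a) (had : a ^ d = n) (h : (Fin d → ℝ) → ℝ≥0∞)
    (x : Fin d → ℝ) :
    (∑' m : Fin d → ℤ, if m = 0 then 0 else
      ENNReal.ofReal |∏ j, a * (B *ᵥ intVec m) j|⁻¹ *
        {x | (fun j => x j / (a * (B *ᵥ intVec m) j)) ∈ dilationBox d}.indicator h x) ≤
    ENNReal.ofReal (4 / n) * {x : Fin d → ℝ | (n : ℝ) ≤ ∏ j, |x j|}.indicator h x := by
  set T : Set (Fin d → ℤ) :=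
    {m | m ≠ 0 ∧ (fun j => x j / (a * (B *ᵥ intVec m) j)) ∈ dilationBox d} with hT
  have hnpos : (0 : ℝ) < n := by exact_mod_cast hn
  have bounds := fun (m : Fin d → ℤ) (hm : m ∈ T) =>
    frolov_prod_bounds hd (hB.one_le_abs_prod m hm.1) ha hm.2
  set p := ∏ j, |x j| with hp
  by_cases hne : T.Nonempty
  swap
  · rw [ENNReal.tsum_eq_zero.2]
    · exact zero_le
    · intro m
      split_ifs with hm
      · rfl
      · rw [Set.indicator_of_notMem, mul_zero]
        exact fun hx => hne ⟨m, hm, hx⟩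
  have hnp : (n : ℝ) ≤ p := by
    obtain ⟨m, hm⟩ := hne
    rw [← had]
    exact (bounds m hm).1
  have hppos : 0 < p := hnpos.trans_le hnp
  have hinj : Function.Injective fun m : Fin d → ℤ => B *ᵥ intVec m :=
    (Matrix.mulVec_injective_iff_isUnit.2 hB.isUnit).comp intVec_injective
  obtain ⟨hfin, hcard⟩ := hB.card_le 0 (fun j => x j / a)
  set L := Set.range (fun m : Fin d → ℤ => B *ᵥ fun i => (m i : ℝ)) ∩
    {z | ∀ j, z j ∈ Set.uIcc ((0 : Fin d → ℝ) j) (x j / a)} with hL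
  have himg : (fun m : Fin d → ℤ => B *ᵥ intVec m) '' T ⊆ L := by
    rintro _ ⟨m, hm, rfl⟩
    exact ⟨⟨m, rfl⟩, (bounds m hm).2.2⟩
  have hTfin : T.Finite := Set.Finite.of_finite_image (hfin.subset himg) hinj.injOn
  -- The box spanned by `0` and `x / a` has volume `p / n ≥ 1`, so the extra `1` in the Frolov count
  -- costs at most a factor `2`.
  have hTcard : (hTfin.toFinset.card : ℝ) ≤ 2 * p / n := by
    rw [← Set.ncard_eq_toFinset_card T hTfin, ← Set.ncard_image_of_injective T hinj]
    have h1 : (((fun m : Fin d → ℤ => B *ᵥ intVec m) '' T).ncard : ℝ) ≤ L.ncard := by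
      exact_mod_cast Set.ncard_le_ncard himg hfin
    refine h1.trans (hcard.trans ?_)
    have h2 : ∏ j, |(0 : Fin d → ℝ) j - x j / a| = p / n := by
      simp only [Pi.zero_apply, zero_sub, abs_neg, abs_div, abs_of_pos ha]
      rw [Finset.prod_div_distrib, Finset.prod_const, Finset.card_univ, Fintype.card_fin, had]
    have h3 : 1 ≤ p / n := (one_le_div hnpos).2 hnp
    rw [h2, mul_div_assoc]
    linarith
  rw [tsum_eq_sum (s := hTfin.toFinset)]
  · have hle : ∀ m ∈ hTfin.toFinset, (if m = 0 then 0 else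
        ENNReal.ofReal |∏ j, a * (B *ᵥ intVec m) j|⁻¹ *
        {x | (fun j => x j / (a * (B *ᵥ intVec m) j)) ∈ dilationBox d}.indicator h x) ≤
        ENNReal.ofReal (2 / p) * h x := by
      intro m hm
      rw [Set.Finite.mem_toFinset] at hm
      rw [if_neg hm.1, Set.indicator_of_mem (by exact hm.2)]
      gcongr
      have : p ≤ 2 * |∏ j, a * (B *ᵥ intVec m) j| := (bounds m hm).2.1
      rw [← inv_div]
      apply inv_anti₀ (by positivity)
      linarith
    refine (Finset.sum_le_sum hle).trans ?_
    rw [Finset.sum_const, nsmul_eq_mul, Set.indicator_of_mem (by exact hnp), ← mul_assoc]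
    gcongr
    rw [← ENNReal.ofReal_natCast, ← ENNReal.ofReal_mul (Nat.cast_nonneg _)]
    refine ENNReal.ofReal_le_ofReal ?_
    -- Number of boxes times largest weight: the dependence on `x` cancels.
    calc (hTfin.toFinset.card : ℝ) * (2 / p) ≤ 2 * p / n * (2 / p) := by gcongr
      _ = 4 / n := by field_simp; norm_num
  · intro m hm
    rw [Set.Finite.mem_toFinset] at hm
    split_ifs with h0
    · rfl
    · rw [Set.indicator_of_notMem, mul_zero]
      exact fun hx => hm ⟨h0, hx⟩

/-- Averaging over the dilations: the mean of the dual lattice sums is controlled by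
the integral over the region outside the hyperbolic cross. -/
theorem lintegral_dilationBox_tsum_le (hd : 1 ≤ d) {B : Matrix (Fin d) (Fin d) ℝ}
    (hB : IsFrolovMatrix B) {n : ℕ} (hn : 1 ≤ n) {h : (Fin d → ℝ) → ℝ≥0∞} (hh : Measurable h) :
    (∫⁻ u in dilationBox d, ∑' m : Fin d → ℤ,
      if m = 0 then 0 else h (dilatedMatrix n u B *ᵥ intVec m)) ≤
    ENNReal.ofReal (4 / n) * ∫⁻ x in {x : Fin d → ℝ | (n : ℝ) ≤ ∏ j, |x j|}, h x := by
  have hnpos : (0 : ℝ) < n := by exact_mod_cast hn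
  set a : ℝ := (n : ℝ) ^ (1 / (d : ℝ)) with ha_def
  have ha : 0 < a := Real.rpow_pos_of_pos hnpos _
  have had : a ^ d = n := dilationFactor_pow hd hnpos.le
  have hD : MeasurableSet {x : Fin d → ℝ | (n : ℝ) ≤ ∏ j, |x j|} :=
    measurableSet_le measurable_const (by fun_prop)
  rw [lintegral_tsum]
  swap
  · intro m
    by_cases hm : m = 0
    · simp [hm]
    · simp only [if_neg hm, dilatedMatrix_mulVec]
      exact (hh.comp (by fun_prop)).aemeasurable
  have hterm : ∀ m : Fin d → ℤ, (∫⁻ u in dilationBox d,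
      if m = 0 then 0 else h (dilatedMatrix n u B *ᵥ intVec m)) =
      ∫⁻ x, if m = 0 then 0 else ENNReal.ofReal |∏ j, a * (B *ᵥ intVec m) j|⁻¹ *
        {x | (fun j => x j / (a * (B *ᵥ intVec m) j)) ∈ dilationBox d}.indicator h x := by
    intro m
    by_cases hm : m = 0
    · simp [hm]
    · simp only [if_neg hm, dilatedMatrix_mulVec]
      refine lintegral_dilationBox_comp_mul hh ?_
      have h1 := hB.one_le_abs_prod m hm
      rw [Finset.prod_mul_distrib]
      refine mul_ne_zero (Finset.prod_ne_zero_iff.2 fun _ _ => ha.ne') fun h0 => ?_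
      change ∏ j, (B *ᵥ fun i => (m i : ℝ)) j = 0 at h0
      rw [h0, abs_zero] at h1
      linarith
  simp_rw [hterm]
  rw [← lintegral_tsum]
  · rw [← lintegral_indicator hD, ← lintegral_const_mul _ (hh.indicator hD)]
    exact lintegral_mono fun x => tsum_overlap_le hd hB hn ha had h x
  · intro m
    by_cases hm : m = 0
    · simp [hm]
    · simp only [if_neg hm]
      refine ((hh.indicator ?_).const_mul _).aemeasurable
      have : Measurable fun (x : Fin d → ℝ) j => x j / (a * (B *ᵥ intVec m) j) := by fun_prop
      exact this measurableSet_dilationBox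

end Averaging

/-! ### Parseval and Plancherel for functions on the unit cell. -/

section Bessel

variable {ι : Type*} [Fintype ι]

theorem volume_unitCell : volume (unitCell ι) = 1 := by
  have : unitCell ι = Set.univ.pi fun _ => Set.Ioc (0 : ℝ) (0 + 1) := by
    ext x; simp [unitCell]
  rw [this, volume_pi_pi]
  simp

theorem integrable_of_memLp_two_of_ae_eq_zero {g : (ι → ℝ) → ℂ} (hg : MemLp g 2)
    (h0 : ∀ᵐ x, x ∉ unitCell ι → g x = 0) : Integrable g := by
  have h1 : Integrable g (volume.restrict (unitCell ι)) := by
    have : IsFiniteMeasure ((volume : Measure (ι → ℝ)).restrict (unitCell ι)) :=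
      ⟨by simp [volume_unitCell]⟩
    exact (hg.restrict _).integrable one_le_two
  refine (integrable_indicator_iff measurableSet_unitCell).2 h1 |>.congr ?_
  filter_upwards [h0] with x hx
  by_cases hxc : x ∈ unitCell ι
  · rw [Set.indicator_of_mem hxc]
  · rw [Set.indicator_of_notMem hxc, hx hxc]

theorem continuous_coordFourier {g : (ι → ℝ) → ℂ} (hg : Integrable g) :
    Continuous (coordFourier g) := by
  refine continuous_of_dominated (bound := fun x => ‖g x‖) (fun ξ => ?_) (fun ξ => ?_) hg.norm ?_
  · exact (continuous_expChar_right ξ).aestronglyMeasurable.mul hg.1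
  · exact Filter.Eventually.of_forall fun x => by rw [norm_mul, norm_expChar, one_mul]
  · exact Filter.Eventually.of_forall fun x => (continuous_expChar_left x).mul continuous_const

theorem setIntegral_unitCell {g : (ι → ℝ) → ℂ} (h0 : ∀ᵐ x, x ∉ unitCell ι → g x = 0)
    (φ : (ι → ℝ) → ℂ) : ∫ x in unitCell ι, φ x * g x = ∫ x, φ x * g x := by
  refine setIntegral_eq_integral_of_ae_compl_eq_zero ?_
  filter_upwards [h0] with x hx hxc
  rw [hx hxc, mul_zero]

/-- Parseval's identity on a translate of the integer lattice. -/
theorem tsum_coordFourier_sq {g : (ι → ℝ) → ℂ} (hg : MemLp g 2)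
    (h0 : ∀ᵐ x, x ∉ unitCell ι → g x = 0) (θ : ι → ℝ) :
    ∑' k : ι → ℤ, ‖coordFourier g (θ + intVec k)‖ₑ ^ 2 = ∫⁻ x, ‖g x‖ₑ ^ 2 := by
  have hu : MemLp (fun x => expChar θ x * g x) 2 := by
    refine hg.of_le ((continuous_expChar_right θ).aestronglyMeasurable.mul hg.1) ?_
    exact Filter.Eventually.of_forall fun x => by rw [norm_mul, norm_expChar, one_mul]
  have hval := measurePreserving_subtype_coe (μa := (volume : Measure (ι → ℝ)))
    (s := unitCell ι) measurableSet_unitCell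
  have hmp := hval.comp (UnitAddTorus.measurePreserving_equivPiIoc (fun _ : ι => (0 : ℝ)))
  have hcoe : ∀ x ∈ unitCell ι,
      (Subtype.val ∘ UnitAddTorus.measurableEquivPiIoc fun _ : ι => (0 : ℝ))
        (fun i => (x i : UnitAddCircle)) = x := fun x hx =>
    congrArg Subtype.val
      ((UnitAddTorus.measurableEquivPiIoc fun _ : ι => (0 : ℝ)).apply_symm_apply ⟨x, hx⟩)
  -- The section from the torus to the cell is made opaque; only these two properties are used.
  obtain ⟨σ, hσ, hcoe⟩ := Exists.intro (p := fun σ : UnitAddTorus ι → ι → ℝ =>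
    MeasurePreserving σ _ (volume.restrict (unitCell ι)) ∧
      ∀ x ∈ unitCell ι, σ (fun i => (x i : UnitAddCircle)) = x) _ ⟨hmp, hcoe⟩
  have hL := (hu.restrict (unitCell ι)).comp_measurePreserving hσ
  have hS := UnitAddTorus.hasSum_sq_mFourierCoeff (hL.toLp _)
  -- Modulating `g` by `expChar θ` shifts its frequencies by `θ`, so Parseval on the torus applies
  -- to the shifted lattice.
  have hcoeff : ∀ k : ι → ℤ, UnitAddTorus.mFourierCoeff (hL.toLp _) k =
      coordFourier g (θ + intVec k) := fun k => by
    have h1 : UnitAddTorus.mFourierCoeff (hL.toLp _) k = UnitAddTorus.mFourierCoeff _ k :=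
      integral_congr_ae (Filter.EventuallyEq.rfl.smul hL.coeFn_toLp)
    rw [h1, mFourierCoeff_eq_unitCell, coordFourier, ← setIntegral_unitCell h0]
    refine setIntegral_congr_fun measurableSet_unitCell fun x hx => ?_
    simp only [Function.comp_def]
    rw [hcoe x hx, add_comm, expChar_add_left, mul_assoc]
  have hint := integral_congr_ae (f := fun t => ‖hL.toLp _ t‖ ^ 2)
    (g := fun t => ‖expChar θ (σ t) * g (σ t)‖ ^ 2)
    (by filter_upwards [hL.coeFn_toLp] with t ht; rw [ht]; rfl)
  rw [hint, UnitAddTorus.integral_preimage _ (fun _ => 0)] at hS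
  have hI : ∫ x in unitCell ι, ‖g x‖ ^ 2 = ∫ x in {x : ι → ℝ | ∀ i, x i ∈ Set.Ioc 0 (0 + 1)},
      ‖expChar θ (σ fun i => (x i : UnitAddCircle)) * g (σ fun i => (x i : UnitAddCircle))‖
        ^ 2 := by
    refine setIntegral_congr_fun measurableSet_unitCell fun x hx => ?_
    rw [hcoe x hx, norm_mul, norm_expChar, one_mul]
  have hI' : ∫ x in unitCell ι, ‖g x‖ ^ 2 = ∫ x, ‖g x‖ ^ 2 := by
    refine setIntegral_eq_integral_of_ae_compl_eq_zero ?_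
    filter_upwards [h0] with x hx hxc
    rw [hx hxc, norm_zero, zero_pow two_ne_zero]
  have hS' : HasSum (fun k : ι → ℤ => ‖coordFourier g (θ + intVec k)‖ ^ 2)
      (∫ x, ‖g x‖ ^ 2) := by
    rw [← hI', hI]
    simp_rw [hcoeff] at hS
    exact hS
  have hsq : ∀ z : ℂ, ‖z‖ₑ ^ 2 = ENNReal.ofReal (‖z‖ ^ 2) := fun z => by
    rw [ENNReal.ofReal_pow (norm_nonneg _), ofReal_norm]
  simp_rw [hsq]
  rw [← ENNReal.ofReal_tsum_of_nonneg (fun _ => sq_nonneg _) hS'.summable, hS'.tsum_eq,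
    ofReal_integral_eq_lintegral_ofReal hg.norm.integrable_sq
      (Filter.Eventually.of_forall fun _ => sq_nonneg _)]

/-- Plancherel's identity for square integrable functions on the unit cell. -/
theorem lintegral_coordFourier_sq {g : (ι → ℝ) → ℂ} (hg : MemLp g 2)
    (h0 : ∀ᵐ x, x ∉ unitCell ι → g x = 0) :
    ∫⁻ ξ, ‖coordFourier g ξ‖ₑ ^ 2 = ∫⁻ x, ‖g x‖ₑ ^ 2 := by
  have hcont := continuous_coordFourier (integrable_of_memLp_two_of_ae_eq_zero hg h0)
  -- Plancherel is Parseval on `θ + ℤ^ι` integrated over `θ` in a cell of volume `1`.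
  rw [lintegral_eq_tsum_unitCell _ (hcont.measurable.enorm.pow_const 2), ← lintegral_tsum]
  · simp_rw [tsum_coordFourier_sq hg h0]
    rw [setLIntegral_const, volume_unitCell, mul_one]
  · intro k
    exact ((hcont.comp (continuous_id.add continuous_const)).measurable.enorm.pow_const
      2).aemeasurable

end Bessel

/-! ### Fourier transforms of weak derivatives, tested with plane waves. -/

section WeakDerivatives

variable {d : ℕ}

theorem foldr_partialDeriv_single (j : Fin d) (s : ℕ) (φ : EuclideanSpace ℝ (Fin d) → ℝ)
    (l : List (Fin d)) (hl : l.Nodup) :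
    l.foldr (fun i ψ => (partialDeriv i)^[(Pi.single j s : Fin d → ℕ) i] ψ) φ =
      if j ∈ l then (partialDeriv j)^[s] φ else φ := by
  induction l with
  | nil => simp
  | cons i l ih =>
    rw [List.nodup_cons] at hl
    rw [List.foldr_cons, ih hl.2]
    by_cases hij : j = i
    · subst hij
      simp [hl.1]
    · simp [hij, Ne.symm hij]

theorem multiDeriv_single (j : Fin d) (s : ℕ) (φ : EuclideanSpace ℝ (Fin d) → ℝ) :
    multiDeriv (Pi.single j s) φ = (partialDeriv j)^[s] φ := by
  rw [multiDeriv, foldr_partialDeriv_single j s φ _ (List.nodup_finRange d)]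
  simp

theorem partialDeriv_iterate_eqOn {O : Set (EuclideanSpace ℝ (Fin d))} (hO : IsOpen O)
    (j : Fin d) {φ ψ : EuclideanSpace ℝ (Fin d) → ℝ} (h : Set.EqOn φ ψ O) (s : ℕ) :
    Set.EqOn ((partialDeriv j)^[s] φ) ((partialDeriv j)^[s] ψ) O := by
  induction s with
  | zero => exact h
  | succ s ih =>
    intro x hx
    rw [Function.iterate_succ_apply', Function.iterate_succ_apply', partialDeriv, partialDeriv,
      (ih.eventuallyEq_of_mem (hO.mem_nhds hx)).fderiv_eq]

/-- The linear phase `x ↦ 2π ξ·x`. -/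
noncomputable def phase (ξ : Fin d → ℝ) : EuclideanSpace ℝ (Fin d) →L[ℝ] ℝ :=
  ∑ i, (2 * Real.pi * ξ i) • EuclideanSpace.proj i

theorem phase_apply (ξ : Fin d → ℝ) (x : EuclideanSpace ℝ (Fin d)) :
    phase ξ x = 2 * Real.pi * (ξ ⬝ᵥ x.ofLp) := by
  simp [phase, dotProduct, Finset.mul_sum, mul_assoc]

/-- A plane wave with frequency `ξ` and phase shift `t`. -/
noncomputable def wave (ξ : Fin d → ℝ) (t : ℝ) (x : EuclideanSpace ℝ (Fin d)) : ℝ :=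
  Real.cos (phase ξ x + t)

theorem contDiff_wave (ξ : Fin d → ℝ) (t : ℝ) : ContDiff ℝ (⊤ : ℕ∞) (wave ξ t) :=
  Real.contDiff_cos.comp ((phase ξ).contDiff.add contDiff_const)

/-- Test functions are real, so cosines with a free phase replace complex exponentials: `cos' θ =
cos (θ + π/2)` keeps the family closed under differentiation. -/
theorem partialDeriv_wave (ξ : Fin d → ℝ) (t c : ℝ) (j : Fin d) :
    partialDeriv j (fun x => c * wave ξ t x) =
      fun x => c * (2 * Real.pi * ξ j) * wave ξ (t + Real.pi / 2) x := by
  funext x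
  have h : HasFDerivAt (fun x => c * wave ξ t x)
      (c • (-Real.sin (phase ξ x + t) • phase ξ)) x :=
    (((phase ξ).hasFDerivAt.add_const t).cos).const_mul c
  rw [partialDeriv, h.fderiv]
  have hph : phase ξ (EuclideanSpace.single j 1) = 2 * Real.pi * ξ j := by
    simp [phase_apply]
  simp only [smul_apply, hph, smul_eq_mul, wave]
  rw [← add_assoc, Real.cos_add_pi_div_two]
  ring

theorem partialDeriv_iterate_wave (ξ : Fin d → ℝ) (t : ℝ) (j : Fin d) (s : ℕ) :
    (partialDeriv j)^[s] (wave ξ t) =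
      fun x => (2 * Real.pi * ξ j) ^ s * wave ξ (t + s * (Real.pi / 2)) x := by
  induction s with
  | zero => simp
  | succ s ih =>
    rw [Function.iterate_succ_apply', ih, partialDeriv_wave]
    funext x
    rw [pow_succ, Nat.cast_succ, add_mul, one_mul, add_assoc]

theorem isCompact_unitCube : IsCompact (unitCube d) := by
  have h : unitCube d =
      (PiLp.homeomorph 2 (fun _ : Fin d => ℝ)) ⁻¹' (Set.univ.pi fun _ => Set.Icc (0 : ℝ) 1) := by
    ext x
    simp [unitCube, PiLp.homeomorph, Pi.le_def, forall_and]
  rw [h, Homeomorph.isCompact_preimage]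
  exact isCompact_univ_pi fun _ => isCompact_Icc

theorem isOpen_openUnitCube : IsOpen (openUnitCube d) := by
  have h : openUnitCube d = ⋂ j : Fin d, {x | x j ∈ Set.Ioo (0 : ℝ) 1} := by
    ext x; simp [openUnitCube]
  rw [h]
  refine isOpen_iInter_of_finite fun j => ?_
  exact isOpen_Ioo.preimage (EuclideanSpace.proj (𝕜 := ℝ) j).continuous

/-- Plane waves lack compact support and must be cut off. Since `χ = 1` on an open neighbourhood of
the cube, the cutoff changes no derivative there. -/
theorem exists_cutoff (d : ℕ) : ∃ (χ : EuclideanSpace ℝ (Fin d) → ℝ)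
    (O : Set (EuclideanSpace ℝ (Fin d))), ContDiff ℝ (⊤ : ℕ∞) χ ∧ HasCompactSupport χ ∧
      IsOpen O ∧ unitCube d ⊆ O ∧ ∀ x ∈ O, χ x = 1 := by
  obtain ⟨r, hr0, hr⟩ := (isCompact_unitCube (d := d)).isBounded.subset_ball_lt 0 0
  let b : ContDiffBump (0 : EuclideanSpace ℝ (Fin d)) := ⟨r, r + 1, hr0, by linarith⟩
  exact ⟨b, Metric.ball 0 r, b.contDiff, b.hasCompactSupport, Metric.isOpen_ball, hr,
    fun x hx => b.one_of_mem_closedBall (Metric.ball_subset_closedBall hx)⟩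

theorem ae_openUnitCube_or_notMem_unitCube :
    ∀ᵐ x : EuclideanSpace ℝ (Fin d), x ∈ openUnitCube d ∨ x ∉ unitCube d := by
  have h := Measure.univ_pi_Ioo_ae_eq_Icc (μ := fun _ : Fin d => (volume : Measure ℝ))
    (f := 0) (g := 1)
  have h' := (PiLp.volume_preserving_ofLp (Fin d)).quasiMeasurePreserving.ae h.mem_iff
  filter_upwards [h'] with x hx
  by_cases hx' : x ∈ openUnitCube d
  · exact Or.inl hx'
  · refine Or.inr fun hc => hx' ?_
    have := hx.2 ⟨fun j => (hc j).1, fun j => (hc j).2⟩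
    exact fun j => this j trivial

theorem multiDeriv_single_eq_zero {j : Fin d} {s : ℕ} {φ : EuclideanSpace ℝ (Fin d) → ℝ}
    {x : EuclideanSpace ℝ (Fin d)} (hx : x ∉ tsupport φ) : multiDeriv (Pi.single j s) φ x = 0 := by
  have h1 : Set.EqOn φ (fun _ => 0) (tsupport φ)ᶜ := fun y hy =>
    image_eq_zero_of_notMem_tsupport hy
  have h2 : ∀ s : ℕ, (partialDeriv j)^[s] (fun _ => (0 : ℝ)) = fun _ => 0 := fun s => by
    induction s with
    | zero => rfl
    | succ s ih =>
      rw [Function.iterate_succ_apply', ih]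
      funext y
      simp [partialDeriv]
  rw [multiDeriv_single,
    partialDeriv_iterate_eqOn (isClosed_tsupport φ).isOpen_compl j h1 s hx, h2]

/-- Test functions supported off the closed cube do not see `f`, so `g` vanishes there by the
fundamental lemma; the boundary of the cube is null. -/
theorem FrolovQuadrature.IsWeakDeriv.ae_eq_zero
    {f g : EuclideanSpace ℝ (Fin d) → ℝ} {j : Fin d} {s : ℕ}
    (h : IsWeakDeriv Set.univ (Pi.single j s) f g) (hf : tsupport f ⊆ unitCube d) :
    ∀ᵐ x, x ∉ openUnitCube d → g x = 0 := by
  have hO : IsOpen (unitCube d)ᶜ := isCompact_unitCube.isClosed.isOpen_compl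
  have h1 : ∀ᵐ x, x ∈ (unitCube d)ᶜ → g x = 0 := by
    refine hO.ae_eq_zero_of_integral_contDiff_smul_eq_zero
      (h.locallyIntegrableOn_right.mono_set (Set.subset_univ _)) fun φ hφ hφc hφs => ?_
    have h2 := h.integral_eq φ hφ hφc (Set.subset_univ _)
    have h3 : ∀ x, f x * multiDeriv (Pi.single j s) φ x = 0 := fun x => by
      by_cases hx : x ∈ tsupport φ
      · rw [image_eq_zero_of_notMem_tsupport fun hxf => hφs hx (hf hxf), zero_mul]
      · rw [multiDeriv_single_eq_zero hx, mul_zero]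
    simp only [h3, integral_zero, Measure.restrict_univ] at h2
    have h7 : ∫ x, g x * φ x = 0 := by
      rcases mul_eq_zero.1 h2.symm with h8 | h8
      · exact absurd h8 (pow_ne_zero _ (by norm_num))
      · exact h8
    simpa only [smul_eq_mul, mul_comm] using h7
  filter_upwards [h1, ae_openUnitCube_or_notMem_unitCube] with x hx hx' hx''
  exact hx (hx'.resolve_left hx'')

theorem FrolovQuadrature.IsWeakDeriv.restrict {f g : EuclideanSpace ℝ (Fin d) → ℝ} {j : Fin d}
    {s : ℕ} (h : IsWeakDeriv Set.univ (Pi.single j s) f g)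
    (G : Set (EuclideanSpace ℝ (Fin d))) : IsWeakDeriv G (Pi.single j s) f g where
  locallyIntegrableOn_left := h.locallyIntegrableOn_left.mono_set (Set.subset_univ _)
  locallyIntegrableOn_right := h.locallyIntegrableOn_right.mono_set (Set.subset_univ _)
  integral_eq φ hφ hφc hφs := by
    have h1 := h.integral_eq φ hφ hφc (Set.subset_univ _)
    simp only [Measure.restrict_univ] at h1
    rw [setIntegral_eq_integral_of_forall_compl_eq_zero, h1,
      setIntegral_eq_integral_of_forall_compl_eq_zero]
    · intro x hx
      rw [image_eq_zero_of_notMem_tsupport fun hx' => hx (hφs hx'), mul_zero]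
    · intro x hx
      rw [multiDeriv_single_eq_zero fun hx' => hx (hφs hx'), mul_zero]

theorem FrolovQuadrature.IsWeakDeriv.ae_eq {f g g' : EuclideanSpace ℝ (Fin d) → ℝ}
    {α : Fin d → ℕ} {G : Set (EuclideanSpace ℝ (Fin d))} (hG : IsOpen G)
    (h : IsWeakDeriv G α f g) (h' : IsWeakDeriv G α f g') :
    ∀ᵐ x, x ∈ G → g x = g' x := by
  have h1 : ∀ᵐ x, x ∈ G → (g - g') x = 0 := by
    refine hG.ae_eq_zero_of_integral_contDiff_smul_eq_zero
      (h.locallyIntegrableOn_right.sub h'.locallyIntegrableOn_right) fun φ hφ hφc hφs => ?_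
    have e : ∫ x in G, g x * φ x = ∫ x in G, g' x * φ x := by
      have := (h.integral_eq φ hφ hφc hφs).symm.trans (h'.integral_eq φ hφ hφc hφs)
      exact mul_left_cancel₀ (pow_ne_zero _ (by norm_num)) this
    have hint : ∀ k : EuclideanSpace ℝ (Fin d) → ℝ, LocallyIntegrableOn k G →
        Integrable fun x => k x * φ x := fun k hk => by
      have h2 := (hk.integrableOn_compact_subset hφs hφc).mul_continuousOn
        hφ.continuous.continuousOn hφc
      refine (integrableOn_iff_integrable_of_support_subset ?_).1 h2
      exact (Function.support_mul_subset_right _ _).trans (subset_tsupport φ)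
    have hset : ∀ k : EuclideanSpace ℝ (Fin d) → ℝ,
        ∫ x in G, k x * φ x = ∫ x, k x * φ x := fun k =>
      setIntegral_eq_integral_of_forall_compl_eq_zero fun x hx => by
        rw [image_eq_zero_of_notMem_tsupport fun hx' => hx (hφs hx'), mul_zero]
    rw [hset, hset] at e
    simp only [smul_eq_mul, Pi.sub_apply, sub_mul, mul_comm (φ _)]
    rw [integral_sub (hint g h.locallyIntegrableOn_right) (hint g' h'.locallyIntegrableOn_right),
      e, sub_self]
  filter_upwards [h1] with x hx hxG
  exact sub_eq_zero.1 (hx hxG)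

theorem FrolovQuadrature.IsWeakDeriv.integral_mul_wave
    {f g : EuclideanSpace ℝ (Fin d) → ℝ} {j : Fin d} {s : ℕ}
    (h : IsWeakDeriv Set.univ (Pi.single j s) f g) (hf : tsupport f ⊆ unitCube d)
    (ξ : Fin d → ℝ) (t : ℝ) :
    ∫ x, g x * wave ξ t x =
      (-1) ^ s * (2 * Real.pi * ξ j) ^ s * ∫ x, f x * wave ξ (t + s * (Real.pi / 2)) x := by
  obtain ⟨χ, O, hχ, hχc, hO, hcube, hone⟩ := exists_cutoff d
  have h1 := h.integral_eq (fun x => χ x * wave ξ t x) (hχ.mul (contDiff_wave ξ t)) hχc.mul_right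
    (Set.subset_univ _)
  have heq : Set.EqOn (fun x => χ x * wave ξ t x) (wave ξ t) O := fun x hx => by
    simp only [hone x hx, one_mul]
  have h2 : ∀ x, f x * multiDeriv (Pi.single j s) (fun x => χ x * wave ξ t x) x =
      (2 * Real.pi * ξ j) ^ s * (f x * wave ξ (t + s * (Real.pi / 2)) x) := fun x => by
    by_cases hx : x ∈ tsupport f
    · rw [multiDeriv_single, partialDeriv_iterate_eqOn hO j heq s (hcube (hf hx)),
        partialDeriv_iterate_wave]
      ring
    · rw [image_eq_zero_of_notMem_tsupport hx]
      ring
  have h3 : ∫ x, g x * (χ x * wave ξ t x) = ∫ x, g x * wave ξ t x := by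
    refine integral_congr_ae ?_
    filter_upwards [h.ae_eq_zero hf] with x hx
    by_cases hxO : x ∈ openUnitCube d
    · rw [hone x (hcube fun j => Set.Ioo_subset_Icc_self (hxO j)), one_mul]
    · rw [hx hxO, zero_mul, zero_mul]
  simp only [h2, Measure.restrict_univ, h3, integral_const_mul, Finset.sum_pi_single',
    Finset.mem_univ, if_true] at h1
  rw [mul_assoc, h1, ← mul_assoc, ← mul_pow]
  norm_num

/-- Since `cos (θ + π/2) = -sin θ`, the two real integrals combine to the integral of `g` against
`exp (-i (2π ξ·x + τ))`. -/
theorem integral_wave_eq_coordFourier {g : EuclideanSpace ℝ (Fin d) → ℝ} (hg : Integrable g)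
    (ξ : Fin d → ℝ) (τ : ℝ) :
    ((∫ x, g x * wave ξ τ x : ℝ) : ℂ) +
      ((∫ x, g x * wave ξ (τ + Real.pi / 2) x : ℝ) : ℂ) * Complex.I =
      Complex.exp (-(τ : ℂ) * Complex.I) * coordFourier (coordFun g) ξ := by
  have hint : ∀ t, Integrable fun x => g x * wave ξ t x := fun t =>
    hg.mul_bdd (c := 1) (contDiff_wave ξ t).continuous.aestronglyMeasurable
      (Filter.Eventually.of_forall fun x => Real.abs_cos_le_one _)
  have h1 : coordFourier (coordFun g) ξ =
      ∫ x : EuclideanSpace ℝ (Fin d), expChar ξ x.ofLp * (g x : ℂ) := by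
    rw [← integral_toLp]
    rfl
  rw [h1, ← integral_const_mul, ← integral_complex_ofReal, ← integral_complex_ofReal,
    ← integral_mul_const, ← integral_add (hint _).ofReal ((hint _).ofReal.mul_const _)]
  refine integral_congr_ae (Filter.Eventually.of_forall fun x => ?_)
  simp only
  rw [← mul_assoc (Complex.exp _), expChar, ← Complex.exp_add, ← phase_apply, wave, wave,
    ← add_assoc, Real.cos_add_pi_div_two, ← add_mul, ← neg_add, ← Complex.ofReal_add,
    ← Complex.ofReal_neg, Complex.exp_mul_I, ← Complex.ofReal_cos, ← Complex.ofReal_sin,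
    Real.cos_neg, Real.sin_neg, add_comm τ]
  push_cast
  ring

theorem FrolovQuadrature.IsWeakDeriv.norm_coordFourier
    {f g : EuclideanSpace ℝ (Fin d) → ℝ} {j : Fin d} {s : ℕ}
    (h : IsWeakDeriv Set.univ (Pi.single j s) f g) (hf : tsupport f ⊆ unitCube d)
    (hfi : Integrable f) (hgi : Integrable g) (ξ : Fin d → ℝ) :
    ‖coordFourier (coordFun g) ξ‖ =
      |2 * Real.pi * ξ j| ^ s * ‖coordFourier (coordFun f) ξ‖ := by
  have h1 := integral_wave_eq_coordFourier hgi ξ 0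
  rw [h.integral_mul_wave hf, h.integral_mul_wave hf, zero_add, zero_add,
    add_comm (Real.pi / 2)] at h1
  -- The `s` derivatives shift the phase by `s π / 2`, which contributes only a unimodular factor.
  have h2 := integral_wave_eq_coordFourier hfi ξ (s * (Real.pi / 2))
  have h3 : coordFourier (coordFun g) ξ = (((-1) ^ s * (2 * Real.pi * ξ j) ^ s : ℝ) : ℂ) *
      (Complex.exp (-((s * (Real.pi / 2) : ℝ) : ℂ) * Complex.I) *
        coordFourier (coordFun f) ξ) := by
    rw [← h2, mul_add, ← mul_assoc, ← Complex.ofReal_mul, ← Complex.ofReal_mul, h1]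
    simp
  rw [h3, norm_mul, norm_mul, Complex.norm_real, ← Complex.ofReal_neg,
    Complex.norm_exp_ofReal_mul_I, one_mul, norm_mul, norm_pow, norm_pow, norm_neg, norm_one,
    one_pow, one_mul, Real.norm_eq_abs]

end WeakDerivatives

/-! ### Decay of the Fourier transform outside the hyperbolic cross. -/

section SobolevDecay

variable {d s : ℕ}

theorem sum_integral_weakDeriv_sq (f : EuclideanSpace ℝ (Fin d) → ℝ) :
    ∑ α ∈ multiIndices d s, ∫ x in openUnitCube d, (weakDeriv (openUnitCube d) α f x) ^ 2 =
      sobolevNormCube d s f ^ 2 := by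
  rw [sobolevNormCube, sobolevNorm, Real.sq_sqrt]
  exact Finset.sum_nonneg fun α _ => integral_nonneg fun x => sq_nonneg _

theorem FrolovQuadrature.MemSobolevCube.hasCompactSupport {f : EuclideanSpace ℝ (Fin d) → ℝ}
    (hf : MemSobolevCube d s f) : HasCompactSupport f :=
  isCompact_unitCube.of_isClosed_subset (isClosed_tsupport f) hf.tsupport_subset

theorem memLp_coordFun {g : EuclideanSpace ℝ (Fin d) → ℝ} (hg : MemLp g 2) :
    MemLp (coordFun g) 2 :=
  (hg.comp_measurePreserving (PiLp.volume_preserving_toLp (Fin d))).ofReal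

theorem lintegral_coordFun_sq {g : EuclideanSpace ℝ (Fin d) → ℝ} (hg : MemLp g 2) :
    ∫⁻ x, ‖coordFun g x‖ₑ ^ 2 = ENNReal.ofReal (∫ x, g x ^ 2) := by
  rw [← integral_toLp, ofReal_integral_eq_lintegral_ofReal]
  · refine lintegral_congr fun x => ?_
    rw [coordFun, ← ofReal_norm, Complex.norm_real, ← ENNReal.ofReal_pow (norm_nonneg _),
      Real.norm_eq_abs, sq_abs]
  · exact (hg.comp_measurePreserving (PiLp.volume_preserving_toLp (Fin d))).integrable_sq
  · exact Filter.Eventually.of_forall fun x => sq_nonneg _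

/-- Weighted `L²` bound for the Fourier transform of a function in the Sobolev space on the cube,
with the weight of a pure derivative of order `s`. -/
theorem lintegral_pow_mul_coordFourier_sq_le {f : EuclideanSpace ℝ (Fin d) → ℝ}
    (hf : MemSobolevCube d s f) (j : Fin d) :
    ∫⁻ ξ, (ENNReal.ofReal (|2 * Real.pi * ξ j| ^ s) * ‖coordFourier (coordFun f) ξ‖ₑ) ^ 2 ≤
      ENNReal.ofReal (sobolevNormCube d s f ^ 2) := by
  have hα : ∑ i, (Pi.single j s : Fin d → ℕ) i ≤ s := by simp
  obtain ⟨g, hg, hgL⟩ := hf.memSobolev.2 (Pi.single j s) hα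
  rw [Measure.restrict_univ] at hgL
  have hg0 := hg.ae_eq_zero hf.tsupport_subset
  have hcell : ∀ᵐ x, x ∉ unitCell (Fin d) → coordFun g x = 0 := by
    have h1 := (PiLp.volume_preserving_toLp (Fin d)).quasiMeasurePreserving.ae hg0
    filter_upwards [h1] with x hx hxc
    rw [coordFun, hx, Complex.ofReal_zero]
    refine fun hxo => hxc fun i => ?_
    rw [zero_add]
    exact Set.Ioo_subset_Ioc_self (hxo i)
  have hgc : Integrable (coordFun g) :=
    integrable_of_memLp_two_of_ae_eq_zero (memLp_coordFun hgL) hcell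
  have hgi : Integrable g := by
    have h1 : Integrable fun x : Fin d → ℝ => g (WithLp.toLp 2 x) := hgc.re
    exact ((PiLp.volume_preserving_toLp (Fin d)).integrable_comp_emb
      (MeasurableEquiv.toLp 2 (Fin d → ℝ)).measurableEmbedding).1 h1
  have hfi : Integrable f := hf.continuous.integrable_of_hasCompactSupport hf.hasCompactSupport
  have h1 : ∀ ξ, ENNReal.ofReal (|2 * Real.pi * ξ j| ^ s) * ‖coordFourier (coordFun f) ξ‖ₑ =
      ‖coordFourier (coordFun g) ξ‖ₑ := fun ξ => by
    rw [← ofReal_norm, ← ofReal_norm, hg.norm_coordFourier hf.tsupport_subset hfi hgi,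
      ENNReal.ofReal_mul (by positivity)]
  simp_rw [h1]
  rw [lintegral_coordFourier_sq (memLp_coordFun hgL) hcell, lintegral_coordFun_sq hgL]
  refine ENNReal.ofReal_le_ofReal ?_
  have hex : ∃ g, IsWeakDeriv (openUnitCube d) (Pi.single j s) f g := ⟨g, hg.restrict _⟩
  have hw : IsWeakDeriv (openUnitCube d) (Pi.single j s) f
      (weakDeriv (openUnitCube d) (Pi.single j s) f) := by
    rw [weakDeriv, dif_pos hex]
    exact hex.choose_spec
  -- The norm uses a chosen weak derivative on the open cube; uniqueness identifies it almost
  -- everywhere with `g`.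
  have hae := (hg.restrict (openUnitCube d)).ae_eq isOpen_openUnitCube hw
  calc ∫ x, g x ^ 2 = ∫ x in openUnitCube d, g x ^ 2 := by
        refine (setIntegral_eq_integral_of_ae_compl_eq_zero ?_).symm
        filter_upwards [hg0] with x hx hxo
        rw [hx hxo, zero_pow two_ne_zero]
    _ = ∫ x in openUnitCube d, (weakDeriv (openUnitCube d) (Pi.single j s) f x) ^ 2 := by
        refine setIntegral_congr_ae isOpen_openUnitCube.measurableSet ?_
        filter_upwards [hae] with x hx hxo
        rw [hx hxo]
    _ ≤ _ := by
        rw [← sum_integral_weakDeriv_sq]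
        exact Finset.single_le_sum
          (f := fun α => ∫ x in openUnitCube d, (weakDeriv (openUnitCube d) α f x) ^ 2)
          (fun α _ => integral_nonneg fun x => sq_nonneg _) ((mem_multiIndices _).2 hα)

theorem measurable_enorm_coordFourier {f : EuclideanSpace ℝ (Fin d) → ℝ}
    (hf : MemSobolevCube d s f) : Measurable fun ξ => ‖coordFourier (coordFun f) ξ‖ₑ :=
  (continuous_coordFourier ((continuous_coordFun hf.continuous).integrable_of_hasCompactSupport
    (hasCompactSupport_coordFun hf.hasCompactSupport))).measurable.enorm

/-- The sup norm is attained at some coordinate, so its weight is dominated by the sum of the `d`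
pure-derivative weights; hence the factor `d`. -/
theorem lintegral_norm_pow_mul_coordFourier_sq_le (hd : 1 ≤ d)
    {f : EuclideanSpace ℝ (Fin d) → ℝ} (hf : MemSobolevCube d s f) :
    ∫⁻ ξ : Fin d → ℝ, (ENNReal.ofReal (‖ξ‖ ^ s) * ‖coordFourier (coordFun f) ξ‖ₑ) ^ 2 ≤
      ENNReal.ofReal (d * sobolevNormCube d s f ^ 2) := by
  have hne : Nonempty (Fin d) := ⟨⟨0, hd⟩⟩
  calc ∫⁻ ξ : Fin d → ℝ, (ENNReal.ofReal (‖ξ‖ ^ s) * ‖coordFourier (coordFun f) ξ‖ₑ) ^ 2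
      ≤ ∫⁻ ξ : Fin d → ℝ, ∑ j,
          (ENNReal.ofReal (|2 * Real.pi * ξ j| ^ s) * ‖coordFourier (coordFun f) ξ‖ₑ) ^ 2 := by
        refine lintegral_mono fun ξ => ?_
        obtain ⟨i, -, hi⟩ := Finset.exists_max_image Finset.univ (fun i => ‖ξ i‖)
          Finset.univ_nonempty
        have hn : ‖ξ‖ ≤ |2 * Real.pi * ξ i| := by
          have h1 : ‖ξ‖ ≤ |ξ i| := (pi_norm_le_iff_of_nonneg (norm_nonneg _)).2
            fun j => hi j (Finset.mem_univ j)
          rw [abs_mul, abs_of_pos Real.two_pi_pos]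
          nlinarith [Real.pi_gt_three, abs_nonneg (ξ i)]
        refine le_trans ?_ (Finset.single_le_sum (f := fun j =>
          (ENNReal.ofReal (|2 * Real.pi * ξ j| ^ s) * ‖coordFourier (coordFun f) ξ‖ₑ) ^ 2)
          (fun _ _ => zero_le) (Finset.mem_univ i))
        dsimp only
        gcongr
    _ = ∑ j, ∫⁻ ξ : Fin d → ℝ,
          (ENNReal.ofReal (|2 * Real.pi * ξ j| ^ s) * ‖coordFourier (coordFun f) ξ‖ₑ) ^ 2 := by
        refine lintegral_finsetSum _ fun j _ => ?_
        have h1 : Measurable fun ξ : Fin d → ℝ => ENNReal.ofReal (|2 * Real.pi * ξ j| ^ s) := by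
          fun_prop
        exact (h1.mul (measurable_enorm_coordFourier hf)).pow_const 2
    _ ≤ ∑ _j : Fin d, ENNReal.ofReal (sobolevNormCube d s f ^ 2) :=
        Finset.sum_le_sum fun j _ => lintegral_pow_mul_coordFourier_sq_le hf j
    _ = _ := by
        rw [Finset.sum_const, Finset.card_univ, Fintype.card_fin, nsmul_eq_mul,
          ENNReal.ofReal_mul (Nat.cast_nonneg d), ENNReal.ofReal_natCast]

/-- The tail integral `∫_{‖x‖ ≥ 1} ‖x‖^{-2s} dx`. -/
noncomputable def tailIntegral (d s : ℕ) : ℝ≥0∞ :=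
  ∫⁻ x : Fin d → ℝ in {x | 1 ≤ ‖x‖}, ENNReal.ofReal (‖x‖⁻¹ ^ s) ^ 2

/-- For `‖x‖ ≥ 1` one has `1 + ‖x‖ ≤ 2 ‖x‖`, and `(1 + ‖x‖)^{-2s}` is integrable because `2s > d`.
-/
theorem tailIntegral_lt_top (hs : (d : ℝ) / 2 < s) : tailIntegral d s < ∞ := by
  have hS : MeasurableSet {x : Fin d → ℝ | 1 ≤ ‖x‖} :=
    measurableSet_le measurable_const measurable_norm
  have h1 : (∫⁻ x : Fin d → ℝ, ENNReal.ofReal ((1 + ‖x‖) ^ (-(2 * s : ℝ)))) < ∞ :=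
    finite_integral_one_add_norm (by rw [Module.finrank_fin_fun]; linarith)
  calc tailIntegral d s
      ≤ ∫⁻ x : Fin d → ℝ in {x | 1 ≤ ‖x‖},
          ENNReal.ofReal (2 ^ (2 * s)) * ENNReal.ofReal ((1 + ‖x‖) ^ (-(2 * s : ℝ))) := by
        refine setLIntegral_mono' hS fun x hx => ?_
        rw [← ENNReal.ofReal_pow (by positivity), ← ENNReal.ofReal_mul (by positivity)]
        refine ENNReal.ofReal_le_ofReal ?_
        have hx1 : (1 : ℝ) ≤ ‖x‖ := hx
        have h2 : (1 + ‖x‖) ^ (-(2 * s : ℝ)) = (1 + ‖x‖)⁻¹ ^ (2 * s) := by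
          rw [Real.rpow_neg (by positivity), inv_pow, ← Real.rpow_natCast]
          push_cast
          rfl
        rw [h2, ← mul_pow, ← pow_mul, mul_comm s 2]
        refine pow_le_pow_left₀ (by positivity) ?_ _
        rw [← div_eq_mul_inv, inv_eq_one_div, div_le_div_iff₀ (by linarith) (by linarith)]
        linarith
    _ ≤ ∫⁻ x : Fin d → ℝ,
          ENNReal.ofReal (2 ^ (2 * s)) * ENNReal.ofReal ((1 + ‖x‖) ^ (-(2 * s : ℝ))) :=
        setLIntegral_le_lintegral _ _
    _ < ∞ := by
        rw [lintegral_const_mul' _ _ ENNReal.ofReal_ne_top]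
        exact ENNReal.mul_lt_top ENNReal.ofReal_lt_top h1

theorem lintegral_tail_eq {a : ℝ} (ha : 0 < a) :
    ∫⁻ x : Fin d → ℝ in {x | a ≤ ‖x‖}, ENNReal.ofReal (‖x‖⁻¹ ^ s) ^ 2 =
      ENNReal.ofReal (a ^ d * (a⁻¹ ^ s) ^ 2) * tailIntegral d s := by
  have hS : ∀ b : ℝ, MeasurableSet {x : Fin d → ℝ | b ≤ ‖x‖} := fun b =>
    measurableSet_le measurable_const measurable_norm
  have hk : Measurable fun x : Fin d → ℝ => ENNReal.ofReal (‖x‖⁻¹ ^ s) ^ 2 := by fun_prop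
  have hmap := Measure.map_addHaar_smul (volume : Measure (Fin d → ℝ)) ha.ne'
  have h1 := lintegral_map (μ := volume) (hk.indicator (hS a))
    (measurable_const_smul a : Measurable fun x : Fin d → ℝ => a • x)
  rw [hmap, lintegral_smul_measure, Module.finrank_fin_fun, abs_of_pos (by positivity),
    smul_eq_mul, lintegral_indicator (hS a)] at h1
  have h2 : ∀ x : Fin d → ℝ,
      {x | a ≤ ‖x‖}.indicator (fun x => ENNReal.ofReal (‖x‖⁻¹ ^ s) ^ 2) (a • x) =
      ENNReal.ofReal ((a⁻¹ ^ s) ^ 2) *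
        {x : Fin d → ℝ | 1 ≤ ‖x‖}.indicator (fun x => ENNReal.ofReal (‖x‖⁻¹ ^ s) ^ 2) x := by
    intro x
    have hnorm : ‖a • x‖ = a * ‖x‖ := by rw [norm_smul, Real.norm_of_nonneg ha.le]
    have hiff : a ≤ a * ‖x‖ ↔ 1 ≤ ‖x‖ := le_mul_iff_one_le_right ha
    by_cases hx : 1 ≤ ‖x‖
    · rw [Set.indicator_of_mem (by rw [Set.mem_ofPred_eq, hnorm]; exact hiff.2 hx),
        Set.indicator_of_mem (by exact hx), hnorm, mul_inv, mul_pow,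
        ENNReal.ofReal_mul (by positivity), mul_pow,
        ENNReal.ofReal_pow (p := a⁻¹ ^ s) (by positivity)]
    · rw [Set.indicator_of_notMem (by rw [Set.mem_ofPred_eq, hnorm]; exact mt hiff.1 hx),
        Set.indicator_of_notMem (by exact hx), mul_zero]
  simp_rw [h2] at h1
  rw [lintegral_const_mul' _ _ ENNReal.ofReal_ne_top, lintegral_indicator (hS 1)] at h1
  rw [ENNReal.ofReal_mul (by positivity), mul_assoc, tailIntegral, ← h1, ← mul_assoc,
    ← ENNReal.ofReal_mul (by positivity), mul_inv_cancel₀ (by positivity), ENNReal.ofReal_one,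
    one_mul]

/-- The `L¹` norm of the Fourier transform outside the hyperbolic cross. -/
theorem lintegral_coordFourier_outside_le (hd : 1 ≤ d) (hs : (d : ℝ) / 2 < s)
    {f : EuclideanSpace ℝ (Fin d) → ℝ} (hf : MemSobolevCube d s f) {a : ℝ} (ha : 0 < a) :
    ∫⁻ ξ in {x : Fin d → ℝ | a ^ d ≤ ∏ j, |x j|}, ‖coordFourier (coordFun f) ξ‖ₑ ≤
      ENNReal.ofReal (√(a ^ d) * a⁻¹ ^ s * √(tailIntegral d s).toReal *
        (√d * sobolevNormCube d s f)) := by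
  have hS : MeasurableSet {x : Fin d → ℝ | a ≤ ‖x‖} :=
    measurableSet_le measurable_const measurable_norm
  -- Isotropic smoothness only controls `‖ξ‖`, so the hyperbolic cross is replaced by the cube
  -- inside it.
  have hsub : {x : Fin d → ℝ | a ^ d ≤ ∏ j, |x j|} ⊆ {x | a ≤ ‖x‖} := by
    intro x hx
    have h1 : ∏ j, |x j| ≤ ‖x‖ ^ d := by
      calc ∏ j, |x j| ≤ ∏ _j : Fin d, ‖x‖ :=
            Finset.prod_le_prod (fun _ _ => abs_nonneg _) fun j _ => norm_le_pi_norm x j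
        _ = ‖x‖ ^ d := by rw [Finset.prod_const, Finset.card_univ, Fintype.card_fin]
    exact le_of_pow_le_pow_left₀ (by omega) (norm_nonneg x) (le_trans hx h1)
  set H := fun ξ : Fin d → ℝ => ‖coordFourier (coordFun f) ξ‖ₑ
  have hH : Measurable H := measurable_enorm_coordFourier hf
  let f₁ : (Fin d → ℝ) → ℝ≥0∞ := fun ξ => ENNReal.ofReal (‖ξ‖⁻¹ ^ s)
  let f₂ : (Fin d → ℝ) → ℝ≥0∞ := fun ξ => ENNReal.ofReal (‖ξ‖ ^ s) * H ξ
  have hf₁ : Measurable f₁ := by fun_prop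
  have hf₂ : Measurable f₂ := by fun_prop
  have hN : 0 ≤ sobolevNormCube d s f := Real.sqrt_nonneg _
  have hT : tailIntegral d s = ENNReal.ofReal (tailIntegral d s).toReal :=
    (ENNReal.ofReal_toReal (tailIntegral_lt_top hs).ne).symm
  have hhalf : ∀ x : ℝ, 0 ≤ x → ENNReal.ofReal x ^ (1 / (2 : ℝ)) = ENNReal.ofReal √x :=
    fun x hx => by rw [ENNReal.ofReal_rpow_of_nonneg hx (by norm_num), Real.sqrt_eq_rpow]
  calc ∫⁻ ξ in {x : Fin d → ℝ | a ^ d ≤ ∏ j, |x j|}, H ξ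
      ≤ ∫⁻ ξ in {x : Fin d → ℝ | a ≤ ‖x‖}, H ξ := lintegral_mono_set hsub
    _ = ∫⁻ ξ in {x : Fin d → ℝ | a ≤ ‖x‖}, (f₁ * f₂) ξ := by
        refine setLIntegral_congr_fun hS fun ξ hξ => ?_
        have hpos : 0 < ‖ξ‖ := ha.trans_le hξ
        simp only [Pi.mul_apply, f₁, f₂]
        rw [← mul_assoc, ← ENNReal.ofReal_mul (by positivity), ← mul_pow,
          inv_mul_cancel₀ hpos.ne', one_pow, ENNReal.ofReal_one, one_mul]
    _ ≤ _ := ENNReal.lintegral_mul_le_Lp_mul_Lq _ Real.HolderConjugate.two_two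
          hf₁.aemeasurable hf₂.aemeasurable
    _ ≤ (ENNReal.ofReal (a ^ d * (a⁻¹ ^ s) ^ 2 * (tailIntegral d s).toReal)) ^ (1 / (2 : ℝ)) *
          (ENNReal.ofReal (d * sobolevNormCube d s f ^ 2)) ^ (1 / (2 : ℝ)) := by
        simp only [ENNReal.rpow_two]
        gcongr
        · rw [lintegral_tail_eq ha, ENNReal.ofReal_mul (p := a ^ d * (a⁻¹ ^ s) ^ 2)
            (by positivity), ← hT]
        · exact (setLIntegral_le_lintegral _ _).trans
            (lintegral_norm_pow_mul_coordFourier_sq_le hd hf)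
    _ = _ := by
        rw [hhalf _ (by positivity), hhalf _ (by positivity),
          ← ENNReal.ofReal_mul (Real.sqrt_nonneg _), Real.sqrt_mul (by positivity),
          Real.sqrt_mul (by positivity), Real.sqrt_sq (by positivity),
          Real.sqrt_mul (Nat.cast_nonneg d), Real.sqrt_sq hN]

end SobolevDecay

/-! ### Measurability, the mean error and the theorem. -/

section Main

variable {d s : ℕ}

theorem det_dilatedMatrix_ne_zero {B : Matrix (Fin d) (Fin d) ℝ} (hB : IsUnit B) {n : ℕ}
    (hn : 1 ≤ n) {u : Fin d → ℝ} (hu : u ∈ dilationBox d) : (dilatedMatrix n u B).det ≠ 0 := by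
  have hnpos : (0 : ℝ) < n := by exact_mod_cast hn
  rw [dilatedMatrix, Matrix.det_smul, Matrix.det_mul, Matrix.det_diagonal]
  refine mul_ne_zero (pow_ne_zero _ (Real.rpow_pos_of_pos hnpos _).ne') (mul_ne_zero ?_ ?_)
  · exact Finset.prod_ne_zero_iff.2 fun j _ => (zero_lt_one.trans_le (hu.1 j)).ne'
  · exact ((Matrix.isUnit_iff_isUnit_det _).1 hB).ne_zero

/-- Each node depends measurably on `u` by the adjugate formula, and the series is a limit of finite
sums wherever the matrix is invertible, in particular on the box. -/
theorem aemeasurable_quadrature {B : Matrix (Fin d) (Fin d) ℝ} (hB : IsUnit B) {n : ℕ}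
    (hn : 1 ≤ n) (v : Fin d → ℝ) {f : EuclideanSpace ℝ (Fin d) → ℝ} (hf : Continuous f)
    (hc : HasCompactSupport f) :
    AEMeasurable (fun u => quadrature (dilatedMatrix n u B) v f)
      (volume.restrict (dilationBox d)) := by
  have hS : Continuous fun u : Fin d → ℝ => dilatedMatrix n u B := by
    unfold dilatedMatrix
    fun_prop
  have hinv : ∀ w : Fin d → ℝ, Measurable fun u => ((dilatedMatrix n u B)⁻¹)ᵀ *ᵥ w := fun w => by
    have h1 : Measurable fun u : Fin d → ℝ => (dilatedMatrix n u B).adjugateᵀ *ᵥ w :=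
      (hS.matrix_adjugate.matrix_transpose.matrix_mulVec continuous_const).measurable
    have h2 : Measurable fun u : Fin d → ℝ => ((dilatedMatrix n u B).det)⁻¹ :=
      hS.matrix_det.measurable.inv
    convert h2.smul h1 using 1
    funext u
    rw [Pi.smul_apply', Matrix.inv_def, Ring.inverse_eq_inv', Matrix.transpose_smul,
      Matrix.smul_mulVec]
  refine AEMeasurable.mul hS.matrix_det.abs.measurable.inv.aemeasurable ?_
  refine aemeasurable_of_tendsto_metrizable_ae Filter.atTop
    (f := fun (t : Finset (Fin d → ℤ)) (u : Fin d → ℝ) => ∑ m ∈ t,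
      f (WithLp.toLp 2 (((dilatedMatrix n u B)⁻¹)ᵀ *ᵥ fun j => (m j : ℝ) + v j)))
    (fun t => ?_) ?_
  · refine (Finset.measurable_sum _ fun m _ => ?_).aemeasurable
    exact hf.measurable.comp ((PiLp.continuous_toLp 2 _).measurable.comp (hinv _))
  · filter_upwards [ae_restrict_mem measurableSet_dilationBox] with u hu
    exact (summable_quadrature hc (det_dilatedMatrix_ne_zero hB hn hu) v).hasSum

theorem volume_dilationBox_ne_zero (hd : 1 ≤ d) : volume (dilationBox d) ≠ 0 := by
  have h1 : (1 : ℝ) < 2 ^ (1 / (d : ℝ)) :=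
    Real.one_lt_rpow one_lt_two (by positivity)
  rw [dilationBox, Real.volume_Icc_pi]
  refine Finset.prod_ne_zero_iff.2 fun j _ => ?_
  rw [ne_eq, ENNReal.ofReal_eq_zero, not_le]
  linarith

theorem volume_dilationBox_ne_top : volume (dilationBox d) ≠ ∞ :=
  isCompact_Icc.measure_lt_top.ne

/-- The mean error of the randomly dilated quadrature rule. -/
theorem lintegral_dilationBox_error_le (hd : 1 ≤ d) (hs : (d : ℝ) / 2 < s)
    {B : Matrix (Fin d) (Fin d) ℝ} (hB : IsFrolovMatrix B) {n : ℕ} (hn : 1 ≤ n) (v : Fin d → ℝ)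
    {f : EuclideanSpace ℝ (Fin d) → ℝ} (hf : MemSobolevCube d s f) :
    ∫⁻ u in dilationBox d, ‖quadrature (dilatedMatrix n u B) v f - ∫ x, f x‖ₑ ≤
      ENNReal.ofReal (4 * √(tailIntegral d s).toReal * √d *
        (n : ℝ) ^ (-(s : ℝ) / (d : ℝ) - 1 / 2) * sobolevNormCube d s f) := by
  have hnpos : (0 : ℝ) < n := by exact_mod_cast hn
  have hdpos : (0 : ℝ) < d := by exact_mod_cast hd
  set a : ℝ := (n : ℝ) ^ (1 / (d : ℝ)) with ha_def
  have ha : 0 < a := Real.rpow_pos_of_pos hnpos _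
  have had : a ^ d = n := dilationFactor_pow hd hnpos.le
  calc ∫⁻ u in dilationBox d, ‖quadrature (dilatedMatrix n u B) v f - ∫ x, f x‖ₑ
      ≤ ∫⁻ u in dilationBox d, ∑' k : Fin d → ℤ,
          if k = 0 then 0 else
            ‖coordFourier (coordFun f) (dilatedMatrix n u B *ᵥ intVec k)‖ₑ :=
        setLIntegral_mono' measurableSet_dilationBox fun u hu =>
          enorm_quadrature_sub_integral_le hf.continuous hf.hasCompactSupport
            (det_dilatedMatrix_ne_zero hB.isUnit hn hu) v
    _ ≤ ENNReal.ofReal (4 / n) * ∫⁻ ξ in {x : Fin d → ℝ | (n : ℝ) ≤ ∏ j, |x j|},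
          ‖coordFourier (coordFun f) ξ‖ₑ :=
        lintegral_dilationBox_tsum_le hd hB hn (measurable_enorm_coordFourier hf)
    _ ≤ ENNReal.ofReal (4 / n) * ENNReal.ofReal (√(a ^ d) * a⁻¹ ^ s *
          √(tailIntegral d s).toReal * (√d * sobolevNormCube d s f)) := by
        gcongr
        rw [← had]
        exact lintegral_coordFourier_outside_le hd hs hf ha
    _ = _ := by
        rw [← ENNReal.ofReal_mul (by positivity), had]
        congr 1
        have h1 : a⁻¹ ^ s = (n : ℝ) ^ (-(s : ℝ) / (d : ℝ)) := by
          rw [ha_def, ← Real.rpow_neg hnpos.le, ← Real.rpow_natCast, ← Real.rpow_mul hnpos.le]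
          congr 1
          field_simp
        have h2 : (n : ℝ) ^ (-(s : ℝ) / (d : ℝ) - 1 / 2) =
            (n : ℝ) ^ (-(s : ℝ) / (d : ℝ)) / √n := by
          rw [Real.rpow_sub hnpos, ← Real.sqrt_eq_rpow]
        rw [h1, h2]
        have h3 : √(n : ℝ) / n = 1 / √n := Real.sqrt_div_self'
        calc 4 / (n : ℝ) * (√n * (n : ℝ) ^ (-(s : ℝ) / (d : ℝ)) * √(tailIntegral d s).toReal *
              (√d * sobolevNormCube d s f))
            = 4 * (√(n : ℝ) / n) * ((n : ℝ) ^ (-(s : ℝ) / (d : ℝ)) *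
              √(tailIntegral d s).toReal * (√d * sobolevNormCube d s f)) := by ring
          _ = _ := by rw [h3]; ring

end Main

theorem mainTheorem6 (d s : ℕ) (hd : 1 ≤ d) (hs : (d : ℝ) / 2 < (s : ℝ))
    (B : Matrix (Fin d) (Fin d) ℝ) (hB : IsFrolovMatrix B) :
    ∃ c : ℝ, 0 < c ∧
      ∀ (Ω : Type*) [MeasurableSpace Ω] (P : Measure Ω) [IsProbabilityMeasure P]
        (U : Ω → Fin d → ℝ), pdf.IsUniform U (dilationBox d) P volume →
      ∀ (n : ℕ), 1 ≤ n → ∀ (v : Fin d → ℝ) (f : EuclideanSpace ℝ (Fin d) → ℝ),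
        MemSobolevCube d s f →
          Integrable (fun ω => |quadrature (dilatedMatrix n (U ω) B) v f - ∫ x, f x|) P ∧
          ∫ ω, |quadrature (dilatedMatrix n (U ω) B) v f - ∫ x, f x| ∂P
            ≤ c * (n : ℝ) ^ (-(s : ℝ) / (d : ℝ) - 1 / 2) * sobolevNormCube d s f := by
  set V := (volume (dilationBox d)).toReal
  set K := 4 * √(tailIntegral d s).toReal * √d
  have hV : 0 < V :=
    ENNReal.toReal_pos (volume_dilationBox_ne_zero hd) volume_dilationBox_ne_top
  have hK : 0 ≤ K := by positivity
  -- `V⁻¹` normalizes Lebesgue measure on the box; adding `1` makes the constant positive without a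
  -- lower bound for `K`.
  refine ⟨V⁻¹ * K + 1, by positivity, fun Ω _ P _ U hU n hn v f hf => ?_⟩
  have hUm : AEMeasurable U P :=
    hU.aemeasurable (volume_dilationBox_ne_zero hd) volume_dilationBox_ne_top
  -- Uniformity says by definition that the law of `U` is normalized Lebesgue measure, so the
  -- expectation becomes an integral over the box.
  have hmap : P.map U = (volume (dilationBox d))⁻¹ • volume.restrict (dilationBox d) := hU
  set q : (Fin d → ℝ) → ℝ := fun u => quadrature (dilatedMatrix n u B) v f - ∫ x, f x
  have hN : 0 ≤ sobolevNormCube d s f := Real.sqrt_nonneg _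
  have hq : AEMeasurable q (P.map U) := by
    rw [hmap]
    exact ((aemeasurable_quadrature hB.isUnit hn v hf.continuous hf.hasCompactSupport).sub_const
      _).smul_measure _
  have hqU : AEMeasurable (fun ω => q (U ω)) P := hq.comp_aemeasurable hUm
  have hbound : ∫⁻ ω, ‖q (U ω)‖ₑ ∂P ≤ ENNReal.ofReal
      (V⁻¹ * (K * (n : ℝ) ^ (-(s : ℝ) / (d : ℝ) - 1 / 2) * sobolevNormCube d s f)) := by
    rw [← lintegral_map' hq.enorm hUm, hmap, lintegral_smul_measure, smul_eq_mul,
      ENNReal.ofReal_mul (by positivity), ENNReal.ofReal_inv_of_pos hV,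
      ENNReal.ofReal_toReal volume_dilationBox_ne_top]
    gcongr
    exact lintegral_dilationBox_error_le hd hs hB hn v hf
  have hint : Integrable (fun ω => q (U ω)) P :=
    ⟨hqU.aestronglyMeasurable, hbound.trans_lt ENNReal.ofReal_lt_top⟩
  refine ⟨hint.abs, ?_⟩
  have h1 : ∫ ω, |q (U ω)| ∂P = (∫⁻ ω, ‖q (U ω)‖ₑ ∂P).toReal :=
    integral_norm_eq_lintegral_enorm hqU.aestronglyMeasurable
  calc ∫ ω, |q (U ω)| ∂P
      ≤ V⁻¹ * (K * (n : ℝ) ^ (-(s : ℝ) / (d : ℝ) - 1 / 2) * sobolevNormCube d s f) := by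
        rw [h1]
        exact ENNReal.toReal_le_of_le_ofReal (by positivity) hbound
    _ = V⁻¹ * K * (n : ℝ) ^ (-(s : ℝ) / (d : ℝ) - 1 / 2) * sobolevNormCube d s f := by ring
    _ ≤ _ := by
        gcongr
        linarith
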